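/- Let $n$ be a nonnegative integer, $J=\begin{pmatrix}0&-I\\ I&0\end{pmatrix}\in\mathbb C^{2n\times 2n}$, and let $H:(0,\infty)\to\mathbb C^{2n\times 2n}$ satisfy $H(x)\ge 0$ for almost every $x$ and $H\in L^1_{\rm loc}(0,\infty)$. Assume that $0$ is a regular endpoint, i.e. $H\in L^1(0,c)$ for some $c>0$, and that $H$ is definite on $(0,\infty)$, i.e. if $w\in\mathbb C^{2n}$ and $H(x)w=0$ for almost every $x\in(0,\infty)$, then $w=0$. Let $L^2_H(0,\infty)$ be the space of measurable $f:(0,\infty)\to\mathbb C^{2n}$ with $\|f\|^2=\int_0^\infty f(x)^*H(x)f(x)\,dx<\infty$, modulo those with $\|f\|=0$. Let $\mathcal T$ be the maximal relation, i.e. the set of $(f,g)\in L^2_H(0,\infty)\oplus L^2_H(0,\infty)$ such that $f$ has a locally absolutely continuous representative $f_0$ with $Jf_0'=-Hg$ almost everywhere on $(0,\infty)$. Assume that both deficiency indices, i.e. the dimensions of $\ker(\mathcal T-i)$ and $\ker(\mathcal T+i)$, where $\ker(\mathcal T-z)=\{f:(f,zf)\in\mathcal T\}$, are equal to $n$. Let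 $\alpha\in\mathbb C^{n\times 2n}$ satisfy $\alpha\alpha^*=I$ and $\alpha J\alpha^*=0$, and for $z\in\mathbb C$ let $u(\cdot,z),v(\cdot,z):[0,\infty)\to\mathbb C^{2n\times n}$ be the locally absolutely continuous solutions of $Jy'=-zHy$ with $u(0,z)=-J\alpha^*$ and $v(0,z)=\alpha^*$. Then for every $z\in\mathbb C\setminus\mathbb R$ there exists a unique matrix $m(z)\in\mathbb C^{n\times n}$ such that the columns of $v(x,z)+u(x,z)m(z)$ are in $L^2_H(0,\infty)$. Moreover, $\operatorname{Im} m(z)=\frac1{2i}\left(m(z)-m(z)^*\right)$ is positive definite for every $z$ in the open upper half plane, and $m(\overline z)=m(z)^*$ for every $z\in\mathbb C\setminus\mathbb R$. -/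

import Mathlib

open MeasureTheory Set Complex
open scoped Matrix ComplexConjugate ComplexOrder

theorem norm_mulVec_le_sum {ι : Type*} [Fintype ι] (A : Matrix ι ι ℂ) (x : ι → ℂ) :
    ‖A *ᵥ x‖ ≤ (∑ i, ∑ j, ‖A i j‖) * ‖x‖ := by
  refine (pi_norm_le_iff_of_nonneg (by positivity)).2 fun i => ?_
  calc ‖(A *ᵥ x) i‖ ≤ ∑ j, ‖A i j * x j‖ := norm_sum_le _ _
    _ ≤ ∑ j, ‖A i j‖ * ‖x‖ := by
        gcongr with j
        rw [norm_mul]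
        gcongr
        exact norm_le_pi_norm x j
    _ = (∑ j, ‖A i j‖) * ‖x‖ := by rw [Finset.sum_mul]
    _ ≤ _ := by
        refine mul_le_mul_of_nonneg_right ?_ (norm_nonneg x)
        exact Finset.single_le_sum (f := fun i => ∑ j, ‖A i j‖)
          (fun _ _ => by positivity) (Finset.mem_univ i)

theorem intervalIntegrable_mulVec {ι : Type*} [Fintype ι] {A : ℝ → Matrix ι ι ℂ} {b : ℝ}
    (hA : ∀ i j, IntervalIntegrable (fun x => A x i j) volume 0 b) {f : ℝ → ι → ℂ}
    (hf : ContinuousOn f (uIcc 0 b)) :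
    IntervalIntegrable (fun x => A x *ᵥ f x) volume 0 b := by
  have h : ∀ i, IntervalIntegrable (fun x => (A x *ᵥ f x) i) volume 0 b := by
    intro i
    have : (fun x => (A x *ᵥ f x) i) = ∑ j, fun x => A x i j * f x j := by
      ext x; simp [Matrix.mulVec, dotProduct]
    rw [this]
    exact IntervalIntegrable.sum _ fun j _ =>
      (hA i j).mul_continuousOn ((continuous_apply j).comp_continuousOn hf)
  rw [intervalIntegrable_iff]
  exact Integrable.of_eval fun i => (intervalIntegrable_iff.1 (h i))

theorem exists_volterra {ι : Type*} [Fintype ι] (A : ℝ → Matrix ι ι ℂ)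
    (hA : ∀ b, 0 ≤ b → ∀ i j, IntervalIntegrable (fun x => A x i j) volume 0 b) (c : ι → ℂ) :
    ∃ f : ℝ → ι → ℂ, (∀ b, 0 ≤ b → ContinuousOn f (Icc 0 b)) ∧
      ∀ x, 0 ≤ x → f x = c + ∫ s in (0 : ℝ)..x, A s *ᵥ f s := by
  classical
  let P : ℕ → ℝ → ι → ℂ := fun k =>
    Nat.rec (fun _ => c) (fun _ g x => ∫ s in (0 : ℝ)..x, A s *ᵥ g s) k
  have P0 : P 0 = fun _ => c := rfl
  have Ps : ∀ k, P (k + 1) = fun x => ∫ s in (0 : ℝ)..x, A s *ᵥ P k s := fun k => rfl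
  let κ : ℝ → ℝ := fun s => ∑ i, ∑ j, ‖A s i j‖
  have κ0 : ∀ s, 0 ≤ κ s := fun s => by positivity
  have hκ : ∀ b, 0 ≤ b → IntervalIntegrable κ volume 0 b := by
    intro b hb
    have : κ = ∑ i, ∑ j, fun s => ‖A s i j‖ := by ext s; simp [κ]
    rw [this]
    exact IntervalIntegrable.sum _ fun i _ => IntervalIntegrable.sum _ fun j _ => (hA b hb i j).norm
  let a : ℝ → ℝ := fun x => ∫ s in (0 : ℝ)..x, κ s
  have a0 : ∀ x, 0 ≤ x → 0 ≤ a x := fun x hx =>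
    intervalIntegral.integral_nonneg hx fun s _ => κ0 s
  have Pc : ∀ k b, 0 ≤ b → ContinuousOn (P k) (uIcc 0 b) := by
    intro k
    induction k with
    | zero => intro b _; rw [P0]; exact continuousOn_const
    | succ k ih =>
      intro b hb
      rw [Ps]
      exact intervalIntegral.continuousOn_primitive_interval
        ((intervalIntegrable_iff' (by simp)).1 (intervalIntegrable_mulVec (hA b hb) (ih b hb)))
  have aAC : ∀ b, 0 ≤ b → AbsolutelyContinuousOnInterval a 0 b := fun b hb =>
    (hκ b hb).absolutelyContinuousOnInterval_intervalIntegral (by simp)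
  have powAC : ∀ b, 0 ≤ b → ∀ k : ℕ,
      AbsolutelyContinuousOnInterval (fun x => a x ^ (k + 1)) 0 b := by
    intro b hb k
    induction k with
    | zero => simpa using aAC b hb
    | succ k ih => simpa only [pow_succ _ (k + 1)] using ih.fun_mul (aAC b hb)
  have key : ∀ b, 0 ≤ b → ∀ k : ℕ,
      ∫ s in (0 : ℝ)..b, κ s * a s ^ k = a b ^ (k + 1) / (k + 1) := by
    intro b hb k
    have h1 := (powAC b hb k).integral_deriv_eq_sub
    have h2 : a 0 = 0 := by simp [a]
    rw [h2, zero_pow (Nat.succ_ne_zero k), sub_zero] at h1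
    rw [← h1, ← intervalIntegral.integral_div]
    refine intervalIntegral.integral_congr_ae ?_
    filter_upwards [(hκ b hb).ae_hasDerivAt_integral] with x hx hxm
    have hd : HasDerivAt a (κ x) x := hx (uIoc_subset_uIcc hxm) 0 (by simp)
    have := (hd.pow (k + 1)).deriv
    simp only [Nat.add_sub_cancel] at this
    change _ = deriv (a ^ (k + 1)) x / _
    rw [this]
    have : ((k : ℝ) + 1) ≠ 0 := by positivity
    push_cast
    field_simp
  have Pb : ∀ k x, 0 ≤ x → ‖P k x‖ ≤ ‖c‖ * (a x ^ k / k.factorial) := by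
    intro k
    induction k with
    | zero => intro x _; simp [P0]
    | succ k ih =>
      intro x hx
      rw [Ps]
      have hint : IntervalIntegrable (fun s => κ s * a s ^ k) volume 0 x :=
        (hκ x hx).mul_continuousOn (((aAC x hx).continuousOn).pow k)
      calc ‖∫ s in (0 : ℝ)..x, A s *ᵥ P k s‖
          ≤ ∫ s in (0 : ℝ)..x, (‖c‖ / k.factorial) * (κ s * a s ^ k) := by
            refine intervalIntegral.norm_integral_le_of_norm_le hx ?_ (hint.const_mul _)
            refine Filter.Eventually.of_forall fun s hs => ?_
            calc ‖A s *ᵥ P k s‖ ≤ κ s * ‖P k s‖ := norm_mulVec_le_sum _ _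
              _ ≤ κ s * (‖c‖ * (a s ^ k / k.factorial)) := by
                  exact mul_le_mul_of_nonneg_left (ih s hs.1.le) (κ0 s)
              _ = _ := by ring
        _ = (‖c‖ / k.factorial) * (a x ^ (k + 1) / (k + 1)) := by
            rw [intervalIntegral.integral_const_mul, key x hx]
        _ = _ := by
            rw [Nat.factorial_succ]; push_cast
            have : (k.factorial : ℝ) ≠ 0 := by positivity
            field_simp
  have amono : ∀ x b, 0 ≤ x → x ≤ b → a x ≤ a b := by
    intro x b hx hxb
    exact intervalIntegral.integral_mono_interval le_rfl hx hxb
      (Filter.Eventually.of_forall κ0) (hκ b (hx.trans hxb))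
  have bd : ∀ b k x, x ∈ Icc 0 b → ‖P k x‖ ≤ ‖c‖ * (a b ^ k / k.factorial) := by
    intro b k x hx
    refine (Pb k x hx.1).trans ?_
    have := amono x b hx.1 hx.2
    have := a0 x hx.1
    gcongr
  have sm : ∀ b, Summable fun k : ℕ => ‖c‖ * (a b ^ k / k.factorial) := fun b =>
    (Real.summable_pow_div_factorial (a b)).mul_left _
  let f : ℝ → ι → ℂ := fun x => ∑' k, P k x
  have fsum : ∀ x, 0 ≤ x → Summable fun k => P k x := fun x hx =>
    Summable.of_norm_bounded (sm x) fun k => bd x k x ⟨hx, le_rfl⟩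
  have fc : ∀ b, 0 ≤ b → ContinuousOn f (Icc 0 b) := fun b hb =>
    continuousOn_tsum (fun k => by simpa [uIcc_of_le hb] using Pc k b hb) (sm b)
      fun k x hx => bd b k x hx
  refine ⟨f, fc, fun x hx => ?_⟩
  have hs : HasSum (fun k => ∫ s in (0 : ℝ)..x, A s *ᵥ P k s)
      (∫ s in (0 : ℝ)..x, A s *ᵥ f s) := by
    refine intervalIntegral.hasSum_integral_of_dominated_convergence
      (fun k s => κ s * (‖c‖ * (a x ^ k / k.factorial))) ?_ ?_ ?_ ?_ ?_
    · intro k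
      exact (intervalIntegrable_iff.1 (intervalIntegrable_mulVec (hA x hx)
        (Pc k x hx))).aestronglyMeasurable
    · intro k
      refine Filter.Eventually.of_forall fun s hs => ?_
      rw [uIoc_of_le hx] at hs
      refine (norm_mulVec_le_sum _ _).trans ?_
      exact mul_le_mul_of_nonneg_left (bd x k s ⟨hs.1.le, hs.2⟩) (κ0 s)
    · exact Filter.Eventually.of_forall fun s _ => (sm x).mul_left _
    · simp_rw [tsum_mul_left]
      exact (hκ x hx).mul_const _
    · refine Filter.Eventually.of_forall fun s hs => ?_
      rw [uIoc_of_le hx] at hs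
      exact ((fsum s hs.1.le).hasSum).map (Matrix.mulVecLin (A s))
        (LinearMap.continuous_of_finiteDimensional _)
  rw [← hs.tsum_eq]
  exact (fsum x hx).tsum_eq_zero_add

theorem absolutelyContinuousOnInterval_integral {ι : Type*} [Fintype ι] {g : ℝ → ι → ℂ} {b : ℝ}
    (hg : IntervalIntegrable g volume 0 b) :
    AbsolutelyContinuousOnInterval (fun x => ∫ s in (0 : ℝ)..x, g s) 0 b := by
  have h := hg.norm.absolutelyContinuousOnInterval_intervalIntegral (c := 0) (by simp)
  rw [absolutelyContinuousOnInterval_iff] at h ⊢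
  intro ε hε
  obtain ⟨δ, hδ, H⟩ := h ε hε
  refine ⟨δ, hδ, fun E hE hlt => lt_of_le_of_lt (Finset.sum_le_sum fun i hi => ?_) (H E hE hlt)⟩
  have h1 := (hE.1 i hi).1
  have h2 := (hE.1 i hi).2
  have s1 := hg.mono_set (uIcc_subset_uIcc left_mem_uIcc h1)
  have s2 := hg.mono_set (uIcc_subset_uIcc left_mem_uIcc h2)
  rw [dist_eq_norm, Real.dist_eq, intervalIntegral.integral_interval_sub_left s1 s2,
    intervalIntegral.integral_interval_sub_left s1.norm s2.norm]
  exact intervalIntegral.norm_integral_le_abs_integral_norm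

/-- A canonical system `J u' = -z H u` of order `2 n` on the half line `(0, ∞)` for which `0` is a
regular endpoint: `H ≥ 0` almost everywhere, `H` is locally integrable on `(0, ∞)`, and `H` is
integrable on `(0, c)` for some `c > 0`. Values of `H` outside `(0, ∞)` are irrelevant.
The space `ℂ^{2n}` is modelled by `Fin n ⊕ Fin n → ℂ`, and `J = (0, -I; I, 0)` is
`Matrix.J (Fin n) ℂ`. -/
structure HalfLineCanonicalSystem (n : ℕ) where
  H : ℝ → Matrix (Fin n ⊕ Fin n) (Fin n ⊕ Fin n) ℂ
  posSemidef : ∀ᵐ x ∂volume.restrict (Ioi (0 : ℝ)), (H x).PosSemidef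
  locallyIntegrable : ∀ i j, LocallyIntegrableOn (fun x => H x i j) (Ioi (0 : ℝ))
  regular_zero : ∃ c : ℝ, 0 < c ∧ ∀ i j, IntegrableOn (fun x => H x i j) (Ioo 0 c)

namespace HalfLineCanonicalSystem

variable {n : ℕ} (S : HalfLineCanonicalSystem n)

/-- `H` is definite on `(0, ∞)`. -/
def IsDefinite : Prop :=
  ∀ v : Fin n ⊕ Fin n → ℂ,
    (∀ᵐ x ∂volume.restrict (Ioi (0 : ℝ)), S.H x *ᵥ v = 0) → v = 0

/-- The integrand `f(x)^* H(x) f(x)`, as an extended nonnegative number. -/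
noncomputable def energyDensity (f : ℝ → Fin n ⊕ Fin n → ℂ) (x : ℝ) : ENNReal :=
  ENNReal.ofReal (star (f x) ⬝ᵥ S.H x *ᵥ f x).re

/-- The squared seminorm `∫_0^∞ f(x)^* H(x) f(x) dx`. -/
noncomputable def energy (f : ℝ → Fin n ⊕ Fin n → ℂ) : ENNReal :=
  ∫⁻ x in Ioi (0 : ℝ), S.energyDensity f x

theorem aemeasurable_energyDensity {f : ℝ → Fin n ⊕ Fin n → ℂ}
    (hf : AEMeasurable f (volume.restrict (Ioi (0 : ℝ)))) :
    AEMeasurable (S.energyDensity f) (volume.restrict (Ioi (0 : ℝ))) := by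
  have hH : ∀ i j, AEMeasurable (fun x => S.H x i j) (volume.restrict (Ioi (0 : ℝ))) :=
    fun i j => (S.locallyIntegrable i j).aestronglyMeasurable.aemeasurable
  have hfi : ∀ i, AEMeasurable (fun x => f x i) (volume.restrict (Ioi (0 : ℝ))) :=
    fun i => (measurable_pi_apply i).comp_aemeasurable hf
  refine (Complex.measurable_re.comp_aemeasurable ?_).ennreal_ofReal
  simp only [dotProduct, Matrix.mulVec, Pi.star_apply]
  refine Finset.aemeasurable_fun_sum _ fun i _ => ?_
  refine AEMeasurable.mul ?_ (Finset.aemeasurable_fun_sum _ fun j _ => (hH i j).mul (hfi j))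
  exact continuous_star.measurable.comp_aemeasurable (hfi i)

theorem energy_add_le {f g : ℝ → Fin n ⊕ Fin n → ℂ}
    (hf : AEMeasurable f (volume.restrict (Ioi (0 : ℝ)))) :
    S.energy (f + g) ≤ 2 * S.energy f + 2 * S.energy g := by
  unfold energy
  rw [← lintegral_const_mul' _ _ (by simp), ← lintegral_const_mul' _ _ (by simp),
    ← lintegral_add_left' ((S.aemeasurable_energyDensity hf).const_mul _)]
  refine lintegral_mono_ae ?_
  filter_upwards [S.posSemidef] with x hx
  have h1 := hx.re_dotProduct_nonneg (f x)
  have h2 := hx.re_dotProduct_nonneg (g x)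
  have h3 := hx.re_dotProduct_nonneg (f x - g x)
  simp only [RCLike.re_eq_complex_re] at h1 h2 h3
  unfold energyDensity
  rw [show (2 : ENNReal) = ENNReal.ofReal 2 by simp, ← ENNReal.ofReal_mul (by norm_num),
    ← ENNReal.ofReal_mul (by norm_num), ← ENNReal.ofReal_add (by positivity) (by positivity)]
  refine ENNReal.ofReal_le_ofReal ?_
  simp only [Pi.add_apply, star_add, star_sub, Matrix.mulVec_add, Matrix.mulVec_sub,
    add_dotProduct, dotProduct_add, sub_dotProduct, dotProduct_sub, Complex.add_re,
    Complex.sub_re] at h3 ⊢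
  linarith

theorem energy_smul (c : ℂ) (f : ℝ → Fin n ⊕ Fin n → ℂ) :
    S.energy (c • f) = ENNReal.ofReal (Complex.normSq c) * S.energy f := by
  unfold energy
  rw [← lintegral_const_mul' _ _ (by simp)]
  refine lintegral_congr fun x => ?_
  unfold energyDensity
  rw [← ENNReal.ofReal_mul (Complex.normSq_nonneg c)]
  congr 1
  simp only [Pi.smul_apply, star_smul, Matrix.mulVec_smul, smul_dotProduct, dotProduct_smul,
    smul_eq_mul]
  rw [← mul_assoc, Complex.star_def, Complex.mul_conj, Complex.re_ofReal_mul]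

/-- The space of measurable `f : (0, ∞) → ℂ^{2n}` with `∫_0^∞ f^* H f dx < ∞`. -/
noncomputable def preL2 : Submodule ℂ (ℝ → Fin n ⊕ Fin n → ℂ) where
  carrier := {f | AEMeasurable f (volume.restrict (Ioi (0 : ℝ))) ∧ S.energy f < ⊤}
  zero_mem' := ⟨aemeasurable_const, by simp [energy, energyDensity]⟩
  add_mem' := fun hf hg => ⟨hf.1.add hg.1, (S.energy_add_le hf.1).trans_lt
    (ENNReal.add_lt_top.2 ⟨ENNReal.mul_lt_top (by simp) hf.2,
      ENNReal.mul_lt_top (by simp) hg.2⟩)⟩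
  smul_mem' := fun c f hf => ⟨hf.1.const_smul c, by
    rw [S.energy_smul]; exact ENNReal.mul_lt_top (by simp) hf.2⟩

/-- The functions in `preL2` of seminorm zero. -/
noncomputable def nullSpace : Submodule ℂ S.preL2 where
  carrier := {f | S.energy f = 0}
  zero_mem' := by simp [energy, energyDensity]
  add_mem' := fun {f g} hf hg => by
    have h := S.energy_add_le (g := g) f.2.1
    rw [show S.energy f = 0 from hf, show S.energy g = 0 from hg] at h
    exact le_antisymm (by simpa using h) bot_le
  smul_mem' := fun c f hf => by
    have h := S.energy_smul c f
    rw [show S.energy f = 0 from hf] at h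
    simpa using h

/-- The space `L²_H(0, ∞)`. -/
abbrev L2H : Type := S.preL2 ⧸ S.nullSpace

/-- `J f' = -w` almost everywhere on `(0, ∞)`. -/
def DerivEq (f w : ℝ → Fin n ⊕ Fin n → ℂ) : Prop :=
  ∀ᵐ x ∂volume.restrict (Ioi (0 : ℝ)),
    ∃ d : Fin n ⊕ Fin n → ℂ, HasDerivAt f d x ∧ Matrix.J (Fin n) ℂ *ᵥ d = -w x

/-- The maximal relation: the pairs `(f, g)` in `L²_H ⊕ L²_H` such that `f` has a (locally)
absolutely continuous representative `f₀` with `J f₀' = -H g` almost everywhere. -/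
noncomputable def maximalRelation : Submodule ℂ (S.L2H × S.L2H) where
  carrier := {p | ∃ f₀ g : S.preL2,
    S.nullSpace.mkQ f₀ = p.1 ∧ S.nullSpace.mkQ g = p.2 ∧
    (∀ a b : ℝ, 0 < a → 0 < b →
      AbsolutelyContinuousOnInterval (f₀ : ℝ → Fin n ⊕ Fin n → ℂ) a b) ∧
    DerivEq (f₀ : ℝ → Fin n ⊕ Fin n → ℂ)
      (fun x => S.H x *ᵥ (g : ℝ → Fin n ⊕ Fin n → ℂ) x)}
  zero_mem' := ⟨0, 0, by simp, by simp,
    fun a b _ _ => (LipschitzWith.const (0 : Fin n ⊕ Fin n → ℂ)).lipschitzOnWith.absolutelyContinuousOnInterval,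
    Filter.Eventually.of_forall fun x => ⟨0, hasDerivAt_const x (0 : Fin n ⊕ Fin n → ℂ), by simp⟩⟩
  add_mem' := by
    rintro p q ⟨f, g, hf, hg, hac, hd⟩ ⟨f', g', hf', hg', hac', hd'⟩
    refine ⟨f + f', g + g', by simp [← hf, ← hf'], by simp [← hg, ← hg'],
      fun a b ha hb => (hac a b ha hb).add (hac' a b ha hb), ?_⟩
    filter_upwards [hd, hd'] with x ⟨d, h1, h2⟩ ⟨d', h1', h2'⟩
    refine ⟨d + d', h1.add h1', ?_⟩
    simp only [Matrix.mulVec_add, h2, h2', Submodule.coe_add, Pi.add_apply]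
    abel
  smul_mem' := by
    rintro c p ⟨f, g, hf, hg, hac, hd⟩
    refine ⟨c • f, c • g, by simp [← hf], by simp [← hg],
      fun a b ha hb => (hac a b ha hb).const_smul c, ?_⟩
    filter_upwards [hd] with x ⟨d, h1, h2⟩
    refine ⟨c • d, h1.const_smul c, ?_⟩
    simp only [Matrix.mulVec_smul, h2, Submodule.coe_smul, Pi.smul_apply, smul_neg]

/-- `ker(T - z)` for the maximal relation `T`, that is, `{f : (f, z f) ∈ T}`. -/
noncomputable def defectSpace (z : ℂ) : Submodule ℂ S.L2H :=
  S.maximalRelation.comap (LinearMap.prod LinearMap.id (z • LinearMap.id))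

/-- The dimension of `ker(T - z)`. The deficiency indices of `H` are the values at `z = i` and
`z = -i`. -/
noncomputable def defect (z : ℂ) : Cardinal := Module.rank ℂ (S.defectSpace z)

/-- `f` is a solution of `J f' = -z H f` on `[0, ∞)`: it is absolutely continuous on `[0, b]` for
every `b > 0` (the regular endpoint `0` is included) and satisfies the equation almost
everywhere. -/
def IsSolution (z : ℂ) (f : ℝ → Fin n ⊕ Fin n → ℂ) : Prop :=
  (∀ b : ℝ, 0 < b → AbsolutelyContinuousOnInterval f 0 b) ∧
    DerivEq f (fun x => z • (S.H x *ᵥ f x))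

theorem intervalIntegrable_H (b : ℝ) (hb : 0 ≤ b) (i j : Fin n ⊕ Fin n) :
    IntervalIntegrable (fun x => S.H x i j) volume 0 b := by
  obtain ⟨c, hc, h⟩ := S.regular_zero
  have h1 : IntervalIntegrable (fun x => S.H x i j) volume 0 c := by
    rw [intervalIntegrable_iff_integrableOn_Ioo_of_le hc.le]
    exact h i j
  refine h1.trans ?_
  rcases hb.eq_or_lt with rfl | hb
  · exact h1.symm
  · rw [intervalIntegrable_iff]
    refine IntegrableOn.mono_set ?_ uIoc_subset_uIcc
    refine ((S.locallyIntegrable i j).mono_set ?_).integrableOn_isCompact isCompact_uIcc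
    intro x hx
    exact lt_of_lt_of_le (lt_min hc hb) hx.1

/-- Existence of the solution of the initial value problem at the regular endpoint. -/
theorem exists_solution (z : ℂ) (c : Fin n ⊕ Fin n → ℂ) :
    ∃ f, S.IsSolution z f ∧ f 0 = c := by
  let A : ℝ → Matrix (Fin n ⊕ Fin n) (Fin n ⊕ Fin n) ℂ :=
    fun x => z • (Matrix.J (Fin n) ℂ * S.H x)
  have hA : ∀ b : ℝ, 0 ≤ b → ∀ i j, IntervalIntegrable (fun x => A x i j) volume 0 b := by
    intro b hb i j
    have : (fun x => A x i j) = fun x => z * ∑ k, Matrix.J (Fin n) ℂ i k * S.H x k j := by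
      ext x; simp [A, Matrix.mul_apply]
    rw [this]
    refine IntervalIntegrable.const_mul ?_ z
    have : (fun x => ∑ k, Matrix.J (Fin n) ℂ i k * S.H x k j)
        = ∑ k, fun x => Matrix.J (Fin n) ℂ i k * S.H x k j := by
      ext x; simp
    rw [this]
    exact IntervalIntegrable.sum _ fun k _ => (S.intervalIntegrable_H b hb k j).const_mul _
  obtain ⟨f, hfc, hf⟩ := exists_volterra A hA c
  have hint : ∀ b : ℝ, 0 ≤ b → IntervalIntegrable (fun x => A x *ᵥ f x) volume 0 b :=
    fun b hb => intervalIntegrable_mulVec (hA b hb) (by simpa [uIcc_of_le hb] using hfc b hb)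
  refine ⟨f, ⟨fun b hb => ?_, ?_⟩, by simpa using hf 0 le_rfl⟩
  · have hcst : AbsolutelyContinuousOnInterval (fun _ : ℝ => c) 0 b :=
      (LipschitzWith.const c).lipschitzOnWith.absolutelyContinuousOnInterval
    have h := hcst.add (absolutelyContinuousOnInterval_integral (hint b hb.le))
    rw [absolutelyContinuousOnInterval_iff] at h ⊢
    intro ε hε
    obtain ⟨δ, hδ, H⟩ := h ε hε
    refine ⟨δ, hδ, fun E hE hlt => lt_of_eq_of_lt (Finset.sum_congr rfl fun i hi => ?_)
      (H E hE hlt)⟩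
    have h1 := (hE.1 i hi).1
    have h2 := (hE.1 i hi).2
    rw [uIcc_of_le hb.le] at h1 h2
    rw [hf _ h1.1, hf _ h2.1]
    rfl
  · have h := ae_all_iff.2 fun N : ℕ => (hint N N.cast_nonneg).ae_hasDerivAt_integral
    unfold DerivEq
    rw [ae_restrict_iff' measurableSet_Ioi]
    filter_upwards [h] with x hx hx0
    have hx0 : 0 < x := hx0
    obtain ⟨N, hN⟩ := exists_nat_ge x
    have hd := hx N (by rw [uIcc_of_le N.cast_nonneg]; exact ⟨hx0.le, hN⟩) 0 (by simp)
    refine ⟨A x *ᵥ f x, ?_, ?_⟩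
    · refine (hd.const_add c).congr_of_eventuallyEq ?_
      filter_upwards [lt_mem_nhds hx0] with y hy
      exact hf y hy.le
    · simp only [A, Matrix.smul_mulVec, Matrix.mulVec_smul, Matrix.mulVec_mulVec, ← mul_assoc,
        Matrix.J_squared]
      simp [Matrix.neg_mulVec]

/-- The solution `f` of `J f' = -z H f` on `[0, ∞)` with `f(0) = c`. -/
noncomputable def solution (z : ℂ) (c : Fin n ⊕ Fin n → ℂ) : ℝ → Fin n ⊕ Fin n → ℂ :=
  Classical.choose (S.exists_solution z c)

/-- The matrix solution of `J Y' = -z H Y` with `Y(0) = C`, column by column. -/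
noncomputable def matrixSolution (C : Matrix (Fin n ⊕ Fin n) (Fin n) ℂ) (z : ℂ) (x : ℝ) :
    Matrix (Fin n ⊕ Fin n) (Fin n) ℂ :=
  Matrix.of fun i j => S.solution z (fun k => C k j) x i

/-- The solution `u(x, z)` with `u(0, z) = -J α^*`. -/
noncomputable def u (α : Matrix (Fin n) (Fin n ⊕ Fin n) ℂ) (z : ℂ) (x : ℝ) :
    Matrix (Fin n ⊕ Fin n) (Fin n) ℂ :=
  S.matrixSolution (-(Matrix.J (Fin n) ℂ * αᴴ)) z x

/-- The solution `v(x, z)` with `v(0, z) = α^*`. -/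
noncomputable def v (α : Matrix (Fin n) (Fin n ⊕ Fin n) ℂ) (z : ℂ) (x : ℝ) :
    Matrix (Fin n ⊕ Fin n) (Fin n) ℂ :=
  S.matrixSolution αᴴ z x

/-- All columns of the matrix function `F` are in `L²_H(0, ∞)`. -/
def ColumnsInL2H (F : ℝ → Matrix (Fin n ⊕ Fin n) (Fin n) ℂ) : Prop :=
  ∀ j, (fun x i => F x i j) ∈ S.preL2

end HalfLineCanonicalSystem

/-- The imaginary part `(M - M^*) / (2 i)` of a square complex matrix. -/
noncomputable def matrixIm {n : ℕ} (M : Matrix (Fin n) (Fin n) ℂ) : Matrix (Fin n) (Fin n) ℂ :=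
  (1 / (2 * Complex.I)) • (M - Mᴴ)

/-! The operator theory of the maximal relation is replaced by estimates for regular problems on [0,
b] and a limit b → ∞. For nonreal w put σ = sign(Im w) and impose at b the condition y(b) ∈ ker
`boundaryMap n σ`, on which σ Im(y^*Jy) ≥ 0. By Green's identity (`green`) the energy of such a
solution is bounded by its data at 0 (`form_le_boundary`), and αy(0) can be prescribed
(`exists_boundaryValues_inverse`). Definiteness makes the energy control y(0)
(`IsDefinite.exists_lower_bound`), so the initial values stay bounded and a limit along an
ultrafilter gives square integrable solutions χ with αχ = a for every a (`exists_weyl_solutions`).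
Hence the space of square integrable solutions has dimension at least n at every nonreal point.

For the reverse inequality, solutions f at z and g at w with matching boundary data at 0 and b
satisfy ‖f - g‖ ≤ (|z - w|/|Im w|) ‖f‖ (`form_sub_le`). In the limit this gives an injective linear
map between the solution spaces whenever |z - w| < |Im w|, so the dimension at z is at most that at
w. Chains of discs link every nonreal z to i or -i, where the deficiency index bounds the dimension
by n (`IsDefinite.finrank_initialValues_le`).

So α is a bijection from the square integrable initial values onto ℂ^n, which is existence and
uniqueness of m(z), with m(z)a = αJχ. Positivity of Im m is the energy inequality for χ, and m(conj
z) = m(z)^* is the J-orthogonality of the solutions χ at z and conj z. -/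

/-! ### Absolute continuity and derivatives of sesquilinear expressions. -/

theorem AbsolutelyContinuousOnInterval.of_dist_le {X Y : Type*} [PseudoMetricSpace X]
    [PseudoMetricSpace Y] {f : ℝ → X} {g : ℝ → Y} {a b : ℝ}
    (hf : AbsolutelyContinuousOnInterval f a b) (h : ∀ x y, dist (g x) (g y) ≤ dist (f x) (f y)) :
    AbsolutelyContinuousOnInterval g a b :=
  squeeze_zero (fun _ => Finset.sum_nonneg fun _ _ => dist_nonneg)
    (fun _ => Finset.sum_le_sum fun _ _ => h _ _) hf

theorem AbsolutelyContinuousOnInterval.const {X : Type*} [PseudoMetricSpace X] (c : X) (a b : ℝ) :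
    AbsolutelyContinuousOnInterval (fun _ => c) a b :=
  (LipschitzWith.const c).lipschitzOnWith.absolutelyContinuousOnInterval

theorem AbsolutelyContinuousOnInterval.sum {ι F : Type*} [SeminormedAddCommGroup F] (s : Finset ι)
    {f : ι → ℝ → F} {a b : ℝ} (hf : ∀ i ∈ s, AbsolutelyContinuousOnInterval (f i) a b) :
    AbsolutelyContinuousOnInterval (fun x => ∑ i ∈ s, f i x) a b := by
  classical
  induction s using Finset.induction_on with
  | empty => simpa using AbsolutelyContinuousOnInterval.const (0 : F) a b
  | insert i s hi ih =>
    simp only [Finset.sum_insert hi]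
    exact (hf i (by simp)).add (ih fun j hj => hf j (by simp [hj]))

/-- The sesquilinear expression `f^* A g` is absolutely continuous when `f` and `g` are. -/
theorem AbsolutelyContinuousOnInterval.star_dotProduct_mulVec {ι : Type*} [Fintype ι]
    (A : Matrix ι ι ℂ) {f g : ℝ → ι → ℂ} {a b : ℝ}
    (hf : AbsolutelyContinuousOnInterval f a b) (hg : AbsolutelyContinuousOnInterval g a b) :
    AbsolutelyContinuousOnInterval (fun x => star (f x) ⬝ᵥ A *ᵥ g x) a b := by
  simp only [dotProduct, Matrix.mulVec, Pi.star_apply]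
  refine .sum _ fun i _ => ?_
  have h1 : AbsolutelyContinuousOnInterval (fun x => star (f x i)) a b :=
    hf.of_dist_le fun x y => by
      rw [dist_star_star]
      exact dist_le_pi_dist _ _ _
  exact h1.fun_smul (.sum _ fun j _ =>
    (hg.of_dist_le (g := fun x => g x j) fun x y => dist_le_pi_dist _ _ _).const_smul (A i j))

/-- Increments of the primitive of g are dominated by those of the primitive of |g|. -/
theorem absolutelyContinuousOnInterval_integral_complex {g : ℝ → ℂ} {b : ℝ}
    (hg : IntervalIntegrable g volume 0 b) :
    AbsolutelyContinuousOnInterval (fun x => ∫ s in (0 : ℝ)..x, g s) 0 b := by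
  have h := hg.norm.absolutelyContinuousOnInterval_intervalIntegral (c := 0) (by simp)
  rw [absolutelyContinuousOnInterval_iff] at h ⊢
  intro ε hε
  obtain ⟨δ, hδ, H⟩ := h ε hε
  refine ⟨δ, hδ, fun E hE hlt => lt_of_le_of_lt (Finset.sum_le_sum fun i hi => ?_) (H E hE hlt)⟩
  have h1 := (hE.1 i hi).1
  have h2 := (hE.1 i hi).2
  have s1 := hg.mono_set (uIcc_subset_uIcc left_mem_uIcc h1)
  have s2 := hg.mono_set (uIcc_subset_uIcc left_mem_uIcc h2)
  rw [dist_eq_norm, Real.dist_eq, intervalIntegral.integral_interval_sub_left s1 s2,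
    intervalIntegral.integral_interval_sub_left s1.norm s2.norm]
  exact intervalIntegral.norm_integral_le_abs_integral_norm

theorem HasDerivAt.star_dotProduct_mulVec {ι : Type*} [Fintype ι]
    (A : Matrix ι ι ℂ) {f g : ℝ → ι → ℂ} {f' g' : ι → ℂ} {x : ℝ}
    (hf : HasDerivAt f f' x) (hg : HasDerivAt g g' x) :
    HasDerivAt (fun x => star (f x) ⬝ᵥ A *ᵥ g x)
      (star f' ⬝ᵥ A *ᵥ g x + star (f x) ⬝ᵥ A *ᵥ g') x := by
  simp only [dotProduct, Matrix.mulVec, Pi.star_apply, ← Finset.sum_add_distrib]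
  rw [hasDerivAt_pi] at hf hg
  exact .fun_sum fun i _ => (hf i).star.mul (.fun_sum fun j _ => (hg j).const_mul (A i j))

/-! ### Green's identity, the fundamental matrix and uniqueness of solutions. -/

namespace HalfLineCanonicalSystem

variable {n : ℕ} (S : HalfLineCanonicalSystem n)

/-- The sesquilinear form `∫_0^b f(x)^* H(x) g(x) dx`. -/
noncomputable def form (b : ℝ) (f g : ℝ → Fin n ⊕ Fin n → ℂ) : ℂ :=
  ∫ x in (0 : ℝ)..b, star (f x) ⬝ᵥ S.H x *ᵥ g x

variable {S} in
theorem IsSolution.continuousOn {z : ℂ} {f : ℝ → Fin n ⊕ Fin n → ℂ} (hf : S.IsSolution z f) :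
    ContinuousOn f (Ici 0) := by
  intro x hx
  have hx : 0 ≤ x := hx
  have h := (hf.1 (x + 1) (by linarith)).continuousOn
  rw [uIcc_of_le (by linarith)] at h
  refine (h x ⟨hx, by linarith⟩).mono_of_mem_nhdsWithin ?_
  rw [← Ici_inter_Iic]
  exact Filter.inter_mem self_mem_nhdsWithin
    (mem_nhdsWithin_of_mem_nhds (Iic_mem_nhds (by linarith)))

theorem intervalIntegrable_form {b : ℝ} (hb : 0 ≤ b) {f g : ℝ → Fin n ⊕ Fin n → ℂ}
    (hf : ContinuousOn f (Ici 0)) (hg : ContinuousOn g (Ici 0)) :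
    IntervalIntegrable (fun x => star (f x) ⬝ᵥ S.H x *ᵥ g x) volume 0 b := by
  have hsub : uIcc 0 b ⊆ Ici 0 := by rw [uIcc_of_le hb]; exact Icc_subset_Ici_self
  have h := intervalIntegrable_mulVec (fun i j => S.intervalIntegrable_H b hb i j) (hg.mono hsub)
  have : (fun x => star (f x) ⬝ᵥ S.H x *ᵥ g x) =
      ∑ i, fun x => star (f x i) * (S.H x *ᵥ g x) i := by
    ext x; simp [dotProduct]
  rw [this]
  refine IntervalIntegrable.sum _ fun i _ => ?_
  refine IntervalIntegrable.continuousOn_mul ?_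
    (continuous_star.comp_continuousOn ((continuous_apply i).comp_continuousOn (hf.mono hsub)))
  rw [intervalIntegrable_iff] at h ⊢
  exact h.eval i

theorem ae_isHermitian : ∀ᵐ x ∂volume.restrict (Ioi (0 : ℝ)), (S.H x).IsHermitian :=
  S.posSemidef.mono fun _ h => h.isHermitian

/-- Green's identity for solutions at two spectral parameters. -/
theorem green {z w : ℂ} {f g : ℝ → Fin n ⊕ Fin n → ℂ} (hf : S.IsSolution z f)
    (hg : S.IsSolution w g) {b : ℝ} (hb : 0 ≤ b) :
    star (f b) ⬝ᵥ Matrix.J (Fin n) ℂ *ᵥ g b - star (f 0) ⬝ᵥ Matrix.J (Fin n) ℂ *ᵥ g 0 =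
      (conj z - w) * S.form b f g := by
  rcases hb.eq_or_lt with rfl | hb'
  · simp [form]
  have hint := S.intervalIntegrable_form hb hf.continuousOn hg.continuousOn
  -- The boundary form minus (conj z - w) times the primitive of f^*Hg is absolutely continuous with
  -- derivative zero almost everywhere, hence constant.
  have hac := ((hf.1 b hb').star_dotProduct_mulVec (Matrix.J (Fin n) ℂ) (hg.1 b hb')).fun_sub
    ((absolutelyContinuousOnInterval_integral_complex hint).const_smul (conj z - w))
  have hder : ∀ᵐ x, x ∈ uIcc 0 b → HasDerivAt
      (fun x => star (f x) ⬝ᵥ Matrix.J (Fin n) ℂ *ᵥ g x -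
        (conj z - w) • ∫ s in (0 : ℝ)..x, star (f s) ⬝ᵥ S.H s *ᵥ g s) 0 x := by
    have h1 := hf.2
    have h2 := hg.2
    have h3 := S.ae_isHermitian
    unfold DerivEq at h1 h2
    rw [ae_restrict_iff' measurableSet_Ioi] at h1 h2 h3
    have h0 : ∀ᵐ x : ℝ, x ≠ 0 := by simp [ae_iff]
    filter_upwards [h0, h1, h2, h3, hint.ae_hasDerivAt_integral] with x hx0 h1 h2 h3 h4 hx
    have hx' := hx
    rw [uIcc_of_le hb] at hx'
    have hpos : x ∈ Ioi (0 : ℝ) := lt_of_le_of_ne hx'.1 hx0.symm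
    obtain ⟨f', hf', ef⟩ := h1 hpos
    obtain ⟨g', hg', eg⟩ := h2 hpos
    have hH := h3 hpos
    refine ((hf'.star_dotProduct_mulVec (Matrix.J (Fin n) ℂ) hg').fun_sub
      ((h4 hx 0 (by simp)).fun_const_smul (conj z - w))).congr_deriv ?_
    have hJ : (Matrix.J (Fin n) ℂ)ᴴ = -Matrix.J (Fin n) ℂ := by
      simp [Matrix.J, Matrix.fromBlocks_conjTranspose, Matrix.fromBlocks_neg]
    -- J^* = -J gives f'^*J = -(Jf')^*; then the equation for f and H^* = H apply.
    have e1 : star f' ⬝ᵥ Matrix.J (Fin n) ℂ *ᵥ g x = conj z * (star (f x) ⬝ᵥ S.H x *ᵥ g x) := by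
      rw [Matrix.dotProduct_mulVec, ← neg_neg (Matrix.J (Fin n) ℂ), ← hJ, Matrix.vecMul_neg,
        ← Matrix.star_mulVec, ef, Matrix.dotProduct_mulVec]
      conv_rhs => rw [← hH.eq]
      rw [← Matrix.star_mulVec]
      simp
    rw [e1, eg, dotProduct_neg, dotProduct_smul]
    simp only [smul_eq_mul]
    ring
  obtain ⟨C, hC⟩ := hac.const_of_ae_hasDerivAt_zero hder
  have e0 := hC 0 (by simp)
  have eb := hC b (by simp)
  simp only [intervalIntegral.integral_same, smul_eq_mul, mul_zero, sub_zero] at e0 eb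
  rw [form, e0, ← eb]
  ring

/-- The solutions at `z` form a linear space. -/
def solutionSpace (z : ℂ) : Submodule ℂ (ℝ → Fin n ⊕ Fin n → ℂ) where
  carrier := {f | S.IsSolution z f}
  zero_mem' := ⟨fun b _ => .const 0 0 b,
    Filter.Eventually.of_forall fun x => ⟨0, hasDerivAt_const x (0 : Fin n ⊕ Fin n → ℂ), by simp⟩⟩
  add_mem' := by
    rintro f g ⟨hf, hfd⟩ ⟨hg, hgd⟩
    refine ⟨fun b hb => (hf b hb).add (hg b hb), ?_⟩
    filter_upwards [hfd, hgd] with x ⟨d, h1, h2⟩ ⟨d', h1', h2'⟩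
    refine ⟨d + d', h1.add h1', ?_⟩
    simp only [Matrix.mulVec_add, h2, h2', Pi.add_apply, smul_add]
    abel
  smul_mem' := by
    rintro c f ⟨hf, hfd⟩
    refine ⟨fun b hb => (hf b hb).const_smul c, ?_⟩
    filter_upwards [hfd] with x ⟨d, h1, h2⟩
    refine ⟨c • d, h1.const_smul c, ?_⟩
    simp only [Matrix.mulVec_smul, h2, Pi.smul_apply, smul_neg, smul_comm c z]

/-- The fundamental matrix of `J Y' = -z H Y` with `Y(0) = 1`. -/
noncomputable def fundamental (z : ℂ) (x : ℝ) : Matrix (Fin n ⊕ Fin n) (Fin n ⊕ Fin n) ℂ :=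
  Matrix.of fun i j => S.solution z (Pi.single j 1) x i

/-- The solution at `z` with initial value `c`, depending linearly on `c`. -/
noncomputable def solutionMap (z : ℂ) :
    (Fin n ⊕ Fin n → ℂ) →ₗ[ℂ] (ℝ → Fin n ⊕ Fin n → ℂ) where
  toFun c x := S.fundamental z x *ᵥ c
  map_add' c d := by ext1 x; exact Matrix.mulVec_add _ _ _
  map_smul' r c := by ext1 x; exact Matrix.mulVec_smul _ _ _

theorem solution_spec (z : ℂ) (c : Fin n ⊕ Fin n → ℂ) :
    S.IsSolution z (S.solution z c) ∧ S.solution z c 0 = c :=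
  Classical.choose_spec (S.exists_solution z c)

theorem solutionMap_eq_sum (z : ℂ) (c : Fin n ⊕ Fin n → ℂ) :
    S.solutionMap z c = ∑ j, c j • S.solution z (Pi.single j 1) := by
  ext x i
  simp [solutionMap, fundamental, Matrix.mulVec, dotProduct, mul_comm]

theorem isSolution_solutionMap (z : ℂ) (c : Fin n ⊕ Fin n → ℂ) :
    S.IsSolution z (S.solutionMap z c) := by
  rw [solutionMap_eq_sum]
  exact (S.solutionSpace z).sum_mem fun j _ =>
    (S.solutionSpace z).smul_mem _ (S.solution_spec z _).1

theorem continuousOn_solutionMap (z : ℂ) (c : Fin n ⊕ Fin n → ℂ) :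
    ContinuousOn (S.solutionMap z c) (Ici 0) :=
  (S.isSolution_solutionMap z c).continuousOn

@[simp]
theorem solutionMap_zero_right (z : ℂ) (c : Fin n ⊕ Fin n → ℂ) : S.solutionMap z c 0 = c := by
  rw [solutionMap_eq_sum]
  ext i
  simp [(S.solution_spec z _).2, Pi.single_apply]

/-- At the parameters conj z and z the factor in `green` vanishes, so the J-form does not depend on
x. -/
theorem star_dotProduct_J_solutionMap (z : ℂ) {f : ℝ → Fin n ⊕ Fin n → ℂ} (hf : S.IsSolution z f)
    (c : Fin n ⊕ Fin n → ℂ) {x : ℝ} (hx : 0 ≤ x) :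
    star (S.solutionMap (conj z) c x) ⬝ᵥ Matrix.J (Fin n) ℂ *ᵥ f x =
      star c ⬝ᵥ Matrix.J (Fin n) ℂ *ᵥ f 0 := by
  have h := S.green (S.isSolution_solutionMap (conj z) c) hf hx
  simpa [sub_eq_zero] using h

theorem fundamental_conj_mul (z : ℂ) {x : ℝ} (hx : 0 ≤ x) :
    (S.fundamental (conj z) x)ᴴ * Matrix.J (Fin n) ℂ * S.fundamental z x = Matrix.J (Fin n) ℂ := by
  refine Matrix.ext_of_mulVec_single fun j => funext fun i => ?_
  have h := S.star_dotProduct_J_solutionMap z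
    (S.isSolution_solutionMap z (Pi.single j 1)) (Pi.single i 1) hx
  rw [solutionMap_zero_right] at h
  change star (S.fundamental (conj z) x *ᵥ Pi.single i 1) ⬝ᵥ
    Matrix.J (Fin n) ℂ *ᵥ (S.fundamental z x *ᵥ Pi.single j 1) = _ at h
  rw [Matrix.star_mulVec, ← Matrix.dotProduct_mulVec, Matrix.mulVec_mulVec, Matrix.mulVec_mulVec]
    at h
  have hs : star (Pi.single i 1 : Fin n ⊕ Fin n → ℂ) = Pi.single i 1 := by
    rw [← Pi.single_star, star_one]
  rw [hs, single_one_dotProduct, single_one_dotProduct] at h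
  exact h

theorem isUnit_fundamental (z : ℂ) {x : ℝ} (hx : 0 ≤ x) : IsUnit (S.fundamental z x) := by
  refine IsUnit.of_mul_eq_one_right
    (-Matrix.J (Fin n) ℂ * ((S.fundamental (conj z) x)ᴴ * Matrix.J (Fin n) ℂ)) ?_
  rw [mul_assoc, S.fundamental_conj_mul z hx, neg_mul, Matrix.J_squared, neg_neg]

/-- Uniqueness of the solution of the initial value problem. -/
theorem eq_solutionMap {z : ℂ} {f : ℝ → Fin n ⊕ Fin n → ℂ} (hf : S.IsSolution z f) {x : ℝ}
    (hx : 0 ≤ x) : f x = S.solutionMap z (f 0) x := by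
  have hd : S.IsSolution z (f - S.solutionMap z (f 0)) :=
    (S.solutionSpace z).sub_mem hf (S.isSolution_solutionMap z (f 0))
  -- Uniqueness by duality: the difference vanishes at 0, so at x it is J-orthogonal to all values
  -- of solutions at conj z, and these fill the whole space.
  have key : ∀ c, star (S.fundamental (conj z) x *ᵥ c) ⬝ᵥ
      Matrix.J (Fin n) ℂ *ᵥ (f - S.solutionMap z (f 0)) x = 0 := fun c => by
    have := S.star_dotProduct_J_solutionMap z hd c hx
    simp only [Pi.sub_apply, solutionMap_zero_right, sub_self, Matrix.mulVec_zero,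
      dotProduct_zero] at this
    exact this
  have h1 : Matrix.J (Fin n) ℂ *ᵥ (f - S.solutionMap z (f 0)) x = 0 := by
    refine dotProduct_star_self_eq_zero.1 ?_
    obtain ⟨c, hc⟩ := Matrix.mulVec_surjective_iff_isUnit.2 (S.isUnit_fundamental (conj z) hx)
      (Matrix.J (Fin n) ℂ *ᵥ (f - S.solutionMap z (f 0)) x)
    have := key c
    rwa [hc] at this
  have h2 := congrArg (fun y => Matrix.J (Fin n) ℂ *ᵥ y) h1
  simp only [Matrix.mulVec_mulVec, Matrix.J_squared, Matrix.mulVec_zero, Matrix.neg_mulVec,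
    Matrix.one_mulVec, neg_eq_zero, Pi.sub_apply] at h2
  exact sub_eq_zero.1 h2

end HalfLineCanonicalSystem

/-! ### The energy form on [0, b] and its relation to L²_H. -/

namespace HalfLineCanonicalSystem

variable {n : ℕ} (S : HalfLineCanonicalSystem n)

section Form

variable {b : ℝ} (hb : 0 ≤ b) {f g h : ℝ → Fin n ⊕ Fin n → ℂ} (hf : ContinuousOn f (Ici 0))
  (hg : ContinuousOn g (Ici 0)) (hh : ContinuousOn h (Ici 0))

include hb hf hg hh in
theorem form_add_right : S.form b f (g + h) = S.form b f g + S.form b f h := by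
  unfold form
  rw [← intervalIntegral.integral_add (S.intervalIntegrable_form hb hf hg)
    (S.intervalIntegrable_form hb hf hh)]
  simp only [Pi.add_apply, Matrix.mulVec_add, dotProduct_add]

theorem form_smul_right (b : ℝ) (t : ℂ) (f g : ℝ → Fin n ⊕ Fin n → ℂ) :
    S.form b f (t • g) = t * S.form b f g := by
  unfold form
  rw [← intervalIntegral.integral_const_mul]
  simp only [Pi.smul_apply, Matrix.mulVec_smul, dotProduct_smul, smul_eq_mul]

include hb in
theorem form_conj (f g : ℝ → Fin n ⊕ Fin n → ℂ) : conj (S.form b f g) = S.form b g f := by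
  unfold form
  rw [← intervalIntegral.intervalIntegral_conj]
  refine intervalIntegral.integral_congr_ae ?_
  have h := S.ae_isHermitian
  rw [ae_restrict_iff' measurableSet_Ioi] at h
  filter_upwards [h] with x hx hxb
  rw [uIoc_of_le hb] at hxb
  rw [starRingEnd_apply, Matrix.star_dotProduct, star_star, Matrix.star_mulVec, (hx hxb.1).eq,
    ← Matrix.dotProduct_mulVec]

include hb hf hg hh in
theorem form_add_left : S.form b (g + h) f = S.form b g f + S.form b h f := by
  rw [← S.form_conj hb f, S.form_add_right hb hf hg hh, map_add, S.form_conj hb, S.form_conj hb]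

include hb in
theorem form_smul_left (t : ℂ) (f g : ℝ → Fin n ⊕ Fin n → ℂ) :
    S.form b (t • g) f = conj t * S.form b g f := by
  rw [← S.form_conj hb f, form_smul_right, map_mul, S.form_conj hb]

include hb hf hg in
/-- Expansion of the quadratic form on a linear combination of two functions. -/
theorem form_combination_re (s t : ℂ) :
    (S.form b (s • f + t • g) (s • f + t • g)).re =
      normSq s * (S.form b f f).re + normSq t * (S.form b g g).re +
        2 * (conj s * t * S.form b f g).re := by
  have hsf : ContinuousOn (s • f) (Ici 0) := hf.const_smul s
  have htg : ContinuousOn (t • g) (Ici 0) := hg.const_smul t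
  rw [S.form_add_right hb (hsf.add htg) hsf htg, S.form_add_left hb hsf hsf htg,
    S.form_add_left hb htg hsf htg]
  simp only [S.form_smul_left hb, form_smul_right]
  rw [← S.form_conj hb f g]
  have e1 : conj s * (s * S.form b f f) = (normSq s : ℂ) * S.form b f f := by
    rw [← mul_assoc, mul_comm (conj s), mul_conj]
  have e2 : conj t * (t * S.form b g g) = (normSq t : ℂ) * S.form b g g := by
    rw [← mul_assoc, mul_comm (conj t), mul_conj]
  have e3 : conj t * (s * conj (S.form b f g)) = conj (conj s * (t * S.form b f g)) := by
    simp only [map_mul, conj_conj]; ring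
  rw [e1, e2, e3]
  simp only [add_re, re_ofReal_mul, conj_re, ← mul_assoc]
  ring

include hb hf in
theorem form_self_re : (S.form b f f).re =
    ∫ x in (0 : ℝ)..b, (star (f x) ⬝ᵥ S.H x *ᵥ f x).re :=
  (Complex.reCLM.intervalIntegral_comp_comm (S.intervalIntegrable_form hb hf hf)).symm

include hb hf in
theorem intervalIntegrable_form_re :
    IntervalIntegrable (fun x => (star (f x) ⬝ᵥ S.H x *ᵥ f x).re) volume 0 b := by
  have h := S.intervalIntegrable_form hb hf hf
  rw [intervalIntegrable_iff] at h ⊢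
  exact h.re

theorem ae_re_nonneg (f : ℝ → Fin n ⊕ Fin n → ℂ) : ∀ᵐ x ∂volume.restrict (Ioi (0 : ℝ)),
    0 ≤ (star (f x) ⬝ᵥ S.H x *ᵥ f x).re :=
  S.posSemidef.mono fun _ h => h.re_dotProduct_nonneg _

include hb hf in
theorem ofReal_form_self_re : ENNReal.ofReal (S.form b f f).re =
    ∫⁻ x in Ioc 0 b, S.energyDensity f x := by
  have hi := S.intervalIntegrable_form_re hb hf
  rw [intervalIntegrable_iff, uIoc_of_le hb] at hi
  rw [S.form_self_re hb hf, intervalIntegral.integral_of_le hb,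
    ofReal_integral_eq_lintegral_ofReal hi
      (ae_restrict_of_ae_restrict_of_subset Ioc_subset_Ioi_self (S.ae_re_nonneg f))]
  rfl

include hb hf in
theorem form_self_re_nonneg : 0 ≤ (S.form b f f).re := by
  rw [S.form_self_re hb hf]
  refine intervalIntegral.integral_nonneg_of_ae_restrict hb ?_
  rw [← restrict_Ioo_eq_restrict_Icc]
  exact ae_restrict_of_ae_restrict_of_subset Ioo_subset_Ioi_self (S.ae_re_nonneg f)

include hb hf in
theorem form_self_re_mono {b' : ℝ} (hbb : b ≤ b') :
    (S.form b f f).re ≤ (S.form b' f f).re := by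
  rw [S.form_self_re hb hf, S.form_self_re (hb.trans hbb) hf]
  refine intervalIntegral.integral_mono_interval le_rfl hb hbb ?_
    (S.intervalIntegrable_form_re (hb.trans hbb) hf)
  exact ae_restrict_of_ae_restrict_of_subset Ioc_subset_Ioi_self (S.ae_re_nonneg f)

include hf in
-- Exhausting (0, ∞) by (0, k] reduces square integrability to a bound on the forms that is uniform
-- in k.
theorem energy_eq_iSup : S.energy f = ⨆ k : ℕ, ENNReal.ofReal (S.form k f f).re := by
  have hU : Ioi (0 : ℝ) = ⋃ k : ℕ, Ioc (0 : ℝ) k := by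
    ext x
    simp only [mem_Ioi, mem_iUnion, mem_Ioc, exists_and_left]
    exact ⟨fun h => ⟨h, exists_nat_ge x⟩, fun h => h.1⟩
  rw [energy, hU, setLIntegral_iUnion_of_directed]
  · exact iSup_congr fun k => (S.ofReal_form_self_re k.cast_nonneg hf).symm
  · exact Monotone.directed_le fun k l hkl => Ioc_subset_Ioc_right (by exact_mod_cast hkl)

include hf in
theorem aemeasurable_of_continuousOn : AEMeasurable f (volume.restrict (Ioi (0 : ℝ))) :=
  (hf.mono Ioi_subset_Ici_self).aemeasurable measurableSet_Ioi

include hf in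
theorem mem_preL2_of_forall_form_le {C : ℝ} (hC : ∀ k : ℕ, (S.form k f f).re ≤ C) :
    f ∈ S.preL2 := by
  refine ⟨aemeasurable_of_continuousOn hf, ?_⟩
  rw [S.energy_eq_iSup hf]
  exact (iSup_le fun k => ENNReal.ofReal_le_ofReal (hC k)).trans_lt ENNReal.ofReal_lt_top

include hb hf in
theorem form_le_energy (h2 : f ∈ S.preL2) : (S.form b f f).re ≤ (S.energy f).toReal := by
  refine (ENNReal.ofReal_le_iff_le_toReal h2.2.ne).1 ?_
  rw [S.ofReal_form_self_re hb hf]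
  exact lintegral_mono_set Ioc_subset_Ioi_self

end Form

theorem continuous_form_solutionMap {b : ℝ} (hb : 0 ≤ b) {f : ℝ → Fin n ⊕ Fin n → ℂ}
    (hf : ContinuousOn f (Ici 0)) (w : ℂ) :
    Continuous fun c => S.form b f (S.solutionMap w c) := by
  let l : (Fin n ⊕ Fin n → ℂ) →ₗ[ℂ] ℂ :=
    { toFun := fun c => S.form b f (S.solutionMap w c)
      map_add' := fun c d => by
        rw [map_add, S.form_add_right hb hf (S.continuousOn_solutionMap w c)
          (S.continuousOn_solutionMap w d)]
      map_smul' := fun t c => by rw [map_smul, form_smul_right]; rfl }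
  exact l.continuous_of_finiteDimensional

/-- Expanding one argument in coordinates leaves conjugates of functionals linear in c, which are
continuous in finite dimension. -/
theorem continuous_form_solutionMap_self {b : ℝ} (hb : 0 ≤ b) (w : ℂ) :
    Continuous fun c => S.form b (S.solutionMap w c) (S.solutionMap w c) := by
  have h : ∀ c, S.form b (S.solutionMap w c) (S.solutionMap w c) =
      ∑ j, c j * conj (S.form b (S.solutionMap w (Pi.single j 1)) (S.solutionMap w c)) := by
    intro c
    let l : (Fin n ⊕ Fin n → ℂ) →ₗ[ℂ] ℂ :=
      { toFun := fun d => S.form b (S.solutionMap w c) (S.solutionMap w d)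
        map_add' := fun d e => by
          rw [map_add, S.form_add_right hb (S.continuousOn_solutionMap w c)
            (S.continuousOn_solutionMap w d) (S.continuousOn_solutionMap w e)]
        map_smul' := fun t d => by rw [map_smul, form_smul_right]; rfl }
    have := l.pi_apply_eq_sum_univ c
    simp only [S.form_conj hb]
    refine this.trans (Finset.sum_congr rfl fun j _ => ?_)
    rw [smul_eq_mul]
    change _ * S.form b _ (S.solutionMap w _) = _
    congr 3
    ext i; simp [Pi.single_apply, eq_comm]
  rw [funext h]
  exact continuous_finsetSum _ fun j _ => (continuous_apply j).mul
    (continuous_conj.comp (S.continuous_form_solutionMap hb (S.continuousOn_solutionMap w _) w))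

/-- The quadratic form of `f - y` depends continuously on the initial value of the solution `y`. -/
theorem continuous_form_sub_solutionMap {b : ℝ} (hb : 0 ≤ b) {f : ℝ → Fin n ⊕ Fin n → ℂ}
    (hf : ContinuousOn f (Ici 0)) (w : ℂ) :
    Continuous fun c =>
      (S.form b (f - S.solutionMap w c) (f - S.solutionMap w c)).re := by
  have h : ∀ c, (S.form b (f - S.solutionMap w c) (f - S.solutionMap w c)).re =
      (S.form b f f).re + (S.form b (S.solutionMap w c) (S.solutionMap w c)).re -
        2 * (S.form b f (S.solutionMap w c)).re := by
    intro c
    have := S.form_combination_re hb hf (S.continuousOn_solutionMap w c) 1 (-1)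
    simp only [one_smul, neg_smul, ← sub_eq_add_neg, map_one, normSq_neg] at this
    rw [this]
    simp
    ring
  rw [funext h]
  exact (continuous_const.add (continuous_re.comp (S.continuous_form_solutionMap_self hb w))).sub
    (continuous_const.mul (continuous_re.comp (S.continuous_form_solutionMap hb hf w)))

/-! ### Consequences of definiteness. -/

variable {S} in
/-- A solution of zero energy vanishes if `H` is definite. -/
theorem IsDefinite.eq_zero_of_energy (hdef : S.IsDefinite) {w : ℂ} {c : Fin n ⊕ Fin n → ℂ}
    (h : S.energy (S.solutionMap w c) = 0) : c = 0 := by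
  have hsol := S.isSolution_solutionMap w c
  have hH : ∀ᵐ x ∂volume.restrict (Ioi (0 : ℝ)), S.H x *ᵥ S.solutionMap w c x = 0 := by
    rw [energy, lintegral_eq_zero_iff'
      (S.aemeasurable_energyDensity (aemeasurable_of_continuousOn hsol.continuousOn))] at h
    filter_upwards [h, S.posSemidef] with x hx hpos
    have h1 : (star (S.solutionMap w c x) ⬝ᵥ S.H x *ᵥ S.solutionMap w c x).re ≤ 0 :=
      ENNReal.ofReal_eq_zero.1 hx
    have h2 := hpos.dotProduct_mulVec_nonneg (S.solutionMap w c x)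
    rw [Complex.le_def] at h2
    refine (hpos.dotProduct_mulVec_zero_iff _).1 (Complex.ext ?_ ?_)
    · exact le_antisymm h1 h2.1
    · exact h2.2.symm
  -- As Hy = 0 almost everywhere, y also solves the equation at parameter 0. So do constants, and
  -- uniqueness makes y constant.
  have hconst : S.IsSolution 0 (S.solutionMap w c) := by
    refine ⟨hsol.1, ?_⟩
    filter_upwards [hH, hsol.2] with x hx ⟨d, hd, e⟩
    exact ⟨d, hd, by simpa [hx] using e⟩
  have hc0 : S.IsSolution 0 (fun _ => c) :=
    ⟨fun b _ => .const c 0 b, Filter.Eventually.of_forall fun x =>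
      ⟨0, hasDerivAt_const x c, by simp⟩⟩
  refine hdef c ?_
  filter_upwards [hH, ae_restrict_mem measurableSet_Ioi] with x hx hx0
  have hx0 : 0 ≤ x := le_of_lt hx0
  rwa [S.eq_solutionMap hconst hx0, solutionMap_zero_right, ← S.eq_solutionMap hc0 hx0] at hx

variable {S} in
/-- If `H` is definite, then the energy on a long enough interval controls the initial value of a
solution. -/
theorem IsDefinite.exists_lower_bound (hdef : S.IsDefinite) (w : ℂ) :
    ∃ (N : ℕ) (δ : ℝ), 0 < δ ∧ ∀ b : ℝ, N ≤ b → ∀ c : Fin n ⊕ Fin n → ℂ,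
      δ * ‖c‖ ^ 2 ≤ (S.form b (S.solutionMap w c) (S.solutionMap w c)).re := by
  let q : ℕ → (Fin n ⊕ Fin n → ℂ) → ℝ :=
    fun k c => (S.form k (S.solutionMap w c) (S.solutionMap w c)).re
  have qc : ∀ k, Continuous (q k) := fun k =>
    continuous_re.comp (S.continuous_form_solutionMap_self k.cast_nonneg w)
  have qmono : ∀ c k l, k ≤ l → q k c ≤ q l c := fun c k l hkl =>
    S.form_self_re_mono k.cast_nonneg (S.continuousOn_solutionMap w c) (by exact_mod_cast hkl)
  have hsph : IsCompact (Metric.sphere (0 : Fin n ⊕ Fin n → ℂ) 1) := isCompact_sphere 0 1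
  -- These closed sets decrease with k and have no common point on the unit sphere, so by
  -- compactness one of them misses the sphere.
  obtain ⟨N, hN⟩ := hsph.elim_directed_family_closed (fun k => {c | q k c ≤ 0})
    (fun k => isClosed_le (qc k) continuous_const) (by
      refine eq_empty_iff_forall_notMem.2 fun c hc => ?_
      have h1 : ‖c‖ = 1 := by simpa using hc.1
      have h2 : c = 0 := hdef.eq_zero_of_energy (w := w) (by
        rw [S.energy_eq_iSup (S.continuousOn_solutionMap w c)]
        refine ENNReal.iSup_eq_zero.2 fun k => ENNReal.ofReal_eq_zero.2 ?_
        exact mem_iInter.1 hc.2 k)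
      simp [h2] at h1)
    (Antitone.directed_ge fun k l hkl c hc => (qmono c k l hkl).trans hc)
  have hpos : ∀ c ∈ Metric.sphere (0 : Fin n ⊕ Fin n → ℂ) 1, 0 < q N c := fun c hc => by
    by_contra! hle
    exact (eq_empty_iff_forall_notMem.1 hN c) ⟨hc, hle⟩
  obtain ⟨δ, hδ, hδq⟩ : ∃ δ : ℝ, 0 < δ ∧
      ∀ c ∈ Metric.sphere (0 : Fin n ⊕ Fin n → ℂ) 1, δ ≤ q N c := by
    -- The sphere is empty when n = 0.
    rcases (Metric.sphere (0 : Fin n ⊕ Fin n → ℂ) 1).eq_empty_or_nonempty with he | hne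
    · exact ⟨1, one_pos, by simp [he]⟩
    · obtain ⟨c₀, hc₀, hmin⟩ := hsph.exists_isMinOn hne (qc N).continuousOn
      exact ⟨q N c₀, hpos c₀ hc₀, fun c hc => hmin hc⟩
  refine ⟨N, δ, hδ, fun b hNb c => ?_⟩
  have hN0 : (0 : ℝ) ≤ N := N.cast_nonneg
  refine le_trans ?_ (S.form_self_re_mono hN0 (S.continuousOn_solutionMap w c) hNb)
  rcases eq_or_ne c 0 with rfl | hc
  · simpa using S.form_self_re_nonneg hN0 (S.continuousOn_solutionMap w 0)
  · have hcn : ‖c‖ ≠ 0 := norm_ne_zero_iff.2 hc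
    have h1 := hδq (((‖c‖⁻¹ : ℝ) : ℂ) • c) (by simp [norm_smul, hcn])
    have h2 : q N (((‖c‖⁻¹ : ℝ) : ℂ) • c) = (‖c‖⁻¹) ^ 2 * q N c := by
      simp only [q]
      rw [map_smul, form_smul_right, S.form_smul_left hN0, conj_ofReal, re_ofReal_mul,
        re_ofReal_mul]
      ring
    rw [h2] at h1
    have h3 := mul_le_mul_of_nonneg_right h1 (sq_nonneg ‖c‖)
    have h4 : (‖c‖⁻¹) ^ 2 * q N c * ‖c‖ ^ 2 = q N c := by field_simp
    rw [h4] at h3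
    exact h3

end HalfLineCanonicalSystem

/-! ### Linear algebra of the boundary conditions. -/

section BoundarySpace

variable {n : ℕ}

/-- The kernel of `boundaryMap σ`, for `σ = ±1`, is the eigenspace of `i J` at `-σ`. -/
noncomputable def boundaryMap (n : ℕ) (σ : ℝ) : (Fin n ⊕ Fin n → ℂ) →ₗ[ℂ] (Fin n → ℂ) where
  toFun x i := x (Sum.inl i) - I * σ * x (Sum.inr i)
  map_add' x y := by ext i; simp only [Pi.add_apply]; ring
  map_smul' t x := by ext i; simp only [Pi.smul_apply, smul_eq_mul, RingHom.id_apply]; ring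

theorem star_dotProduct_J_mulVec (x y : Fin n ⊕ Fin n → ℂ) :
    star x ⬝ᵥ Matrix.J (Fin n) ℂ *ᵥ y =
      ∑ i, (conj (x (Sum.inr i)) * y (Sum.inl i) - conj (x (Sum.inl i)) * y (Sum.inr i)) := by
  simp [Matrix.J, Matrix.fromBlocks_mulVec, dotProduct, Fintype.sum_sum_type, Finset.sum_sub_distrib,
    Matrix.neg_mulVec]
  ring

theorem eq_of_boundaryMap_eq_zero {σ : ℝ} {x : Fin n ⊕ Fin n → ℂ} (hx : boundaryMap n σ x = 0)
    (i : Fin n) : x (Sum.inl i) = I * σ * x (Sum.inr i) :=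
  sub_eq_zero.1 (congrFun hx i)

/-- This sign is why `boundaryMap` is used at the right endpoint: on its kernel σ Im(x^*Jx) ≥ 0, so
the term at b can be dropped from energy estimates. -/
theorem star_dotProduct_J_im_of_boundaryMap {σ : ℝ} {x : Fin n ⊕ Fin n → ℂ}
    (hx : boundaryMap n σ x = 0) :
    (star x ⬝ᵥ Matrix.J (Fin n) ℂ *ᵥ x).im = 2 * σ * ∑ i, normSq (x (Sum.inr i)) := by
  rw [star_dotProduct_J_mulVec, im_sum, Finset.mul_sum]
  refine Finset.sum_congr rfl fun i _ => ?_
  rw [eq_of_boundaryMap_eq_zero hx]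
  simp [normSq_apply]
  ring

/-- For σ = ±1 the two kernels are eigenspaces of the Hermitian matrix iJ at opposite eigenvalues.
This is the source of m(conj z) = m(z)^*. -/
theorem star_dotProduct_J_eq_zero_of_boundaryMap {σ : ℝ} {x y : Fin n ⊕ Fin n → ℂ}
    (hx : boundaryMap n σ x = 0) (hy : boundaryMap n (-σ) y = 0) :
    star y ⬝ᵥ Matrix.J (Fin n) ℂ *ᵥ x = 0 := by
  rw [star_dotProduct_J_mulVec]
  refine Finset.sum_eq_zero fun i _ => ?_
  rw [eq_of_boundaryMap_eq_zero hx, eq_of_boundaryMap_eq_zero hy]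
  simp only [map_mul, map_neg, conj_I, conj_ofReal, ofReal_neg]
  ring

theorem conjTranspose_J : (Matrix.J (Fin n) ℂ)ᴴ = -Matrix.J (Fin n) ℂ := by
  simp [Matrix.J, Matrix.fromBlocks_conjTranspose, Matrix.fromBlocks_neg]

variable {α : Matrix (Fin n) (Fin n ⊕ Fin n) ℂ} (hα : α * αᴴ = 1)
  (hαJ : α * Matrix.J (Fin n) ℂ * αᴴ = 0)

include hα hαJ in
-- The rows (α, αJ) and the columns (α^*, -Jα^*) form square matrices; the hypotheses on α make them
-- inverse in one order, hence in the other.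
theorem boundary_resolution :
    αᴴ * α - Matrix.J (Fin n) ℂ * αᴴ * (α * Matrix.J (Fin n) ℂ) = 1 := by
  have h1 : Matrix.fromRows α (α * Matrix.J (Fin n) ℂ) *
      Matrix.fromCols αᴴ (-(Matrix.J (Fin n) ℂ * αᴴ)) = 1 := by
    rw [Matrix.fromRows_mul_fromCols, ← Matrix.fromBlocks_one]
    congr 1
    · rw [Matrix.mul_neg, ← Matrix.mul_assoc, hαJ, neg_zero]
    · rw [Matrix.mul_neg, Matrix.mul_assoc, ← Matrix.mul_assoc (Matrix.J (Fin n) ℂ),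
        Matrix.J_squared, Matrix.neg_mul, Matrix.one_mul, Matrix.mul_neg, neg_neg, hα]
  have h2 := mul_eq_one_comm.1 h1
  rw [Matrix.fromCols_mul_fromRows, Matrix.neg_mul] at h2
  rw [sub_eq_add_neg]
  exact h2

include hα hαJ in
theorem eq_of_boundary_values (c : Fin n ⊕ Fin n → ℂ) :
    c = αᴴ *ᵥ (α *ᵥ c) -
      (Matrix.J (Fin n) ℂ * αᴴ) *ᵥ ((α * Matrix.J (Fin n) ℂ) *ᵥ c) := by
  rw [Matrix.mulVec_mulVec, Matrix.mulVec_mulVec, ← Matrix.sub_mulVec,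
    boundary_resolution hα hαJ, Matrix.one_mulVec]

include hα hαJ in
-- Inserting `boundary_resolution` to the left of J exhibits αc and αJc as symplectic coordinates of
-- c.
theorem star_dotProduct_J_boundary (c d : Fin n ⊕ Fin n → ℂ) :
    star c ⬝ᵥ Matrix.J (Fin n) ℂ *ᵥ d =
      star (α *ᵥ c) ⬝ᵥ (α * Matrix.J (Fin n) ℂ) *ᵥ d -
        star ((α * Matrix.J (Fin n) ℂ) *ᵥ c) ⬝ᵥ α *ᵥ d := by
  rw [Matrix.star_mulVec, Matrix.star_mulVec, ← Matrix.dotProduct_mulVec,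
    ← Matrix.dotProduct_mulVec, ← dotProduct_sub, Matrix.mulVec_mulVec, Matrix.mulVec_mulVec,
    ← Matrix.sub_mulVec, Matrix.conjTranspose_mul, conjTranspose_J]
  congr 2
  calc Matrix.J (Fin n) ℂ
      = (αᴴ * α - Matrix.J (Fin n) ℂ * αᴴ * (α * Matrix.J (Fin n) ℂ)) * Matrix.J (Fin n) ℂ := by
        rw [boundary_resolution hα hαJ, one_mul]
    _ = αᴴ * (α * Matrix.J (Fin n) ℂ) - -Matrix.J (Fin n) ℂ * αᴴ * α := by
        rw [sub_mul, Matrix.mul_assoc, Matrix.mul_assoc _ _ (Matrix.J (Fin n) ℂ), Matrix.mul_assoc α,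
          Matrix.J_squared, Matrix.mul_neg, Matrix.mul_one, Matrix.mul_neg, Matrix.neg_mul,
          Matrix.neg_mul]

include hα hαJ in
theorem star_dotProduct_J_self_im (c : Fin n ⊕ Fin n → ℂ) :
    (star c ⬝ᵥ Matrix.J (Fin n) ℂ *ᵥ c).im =
      2 * (star (α *ᵥ c) ⬝ᵥ (α * Matrix.J (Fin n) ℂ) *ᵥ c).im := by
  have h : star ((α * Matrix.J (Fin n) ℂ) *ᵥ c) ⬝ᵥ α *ᵥ c =
      conj (star (α *ᵥ c) ⬝ᵥ (α * Matrix.J (Fin n) ℂ) *ᵥ c) := by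
    rw [starRingEnd_apply, Matrix.star_dotProduct]
  rw [star_dotProduct_J_boundary hα hαJ, h, sub_im, conj_im]
  ring

end BoundarySpace

/-! ### Regular boundary value problems on [0, b]. -/

namespace HalfLineCanonicalSystem

variable {n : ℕ} (S : HalfLineCanonicalSystem n)
  {α : Matrix (Fin n) (Fin n ⊕ Fin n) ℂ} (hα : α * αᴴ = 1)
  (hαJ : α * Matrix.J (Fin n) ℂ * αᴴ = 0) {b : ℝ} (hb : 0 ≤ b)
  {σ : ℝ} (hσ : σ = 1 ∨ σ = -1) {w : ℂ} (hw : 0 < σ * w.im)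

include hb in
theorem form_self_im (f : ℝ → Fin n ⊕ Fin n → ℂ) : (S.form b f f).im = 0 :=
  conj_eq_iff_im.1 (S.form_conj hb f f)

include hb in
/-- The energy identity for a solution. -/
theorem energy_identity {g : ℝ → Fin n ⊕ Fin n → ℂ} (hg : S.IsSolution w g) :
    (star (g b) ⬝ᵥ Matrix.J (Fin n) ℂ *ᵥ g b).im + 2 * w.im * (S.form b g g).re =
      (star (g 0) ⬝ᵥ Matrix.J (Fin n) ℂ *ᵥ g 0).im := by
  have h := congrArg im (S.green hg hg hb)
  simp only [sub_im, mul_im, sub_re, conj_re, conj_im, S.form_self_im hb] at h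
  linarith

include hα hαJ hb hσ in
theorem form_add_boundary_eq {g : ℝ → Fin n ⊕ Fin n → ℂ} (hg : S.IsSolution w g)
    (hgb : boundaryMap n σ (g b) = 0) :
    ∑ i, normSq (g b (Sum.inr i)) + σ * w.im * (S.form b g g).re =
      σ * (star (α *ᵥ g 0) ⬝ᵥ (α * Matrix.J (Fin n) ℂ) *ᵥ g 0).im := by
  have h := S.energy_identity hb hg
  rw [star_dotProduct_J_im_of_boundaryMap hgb, star_dotProduct_J_self_im hα hαJ] at h
  have h2 : σ * σ = 1 := by rcases hσ with rfl | rfl <;> norm_num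
  linear_combination (σ / 2) * h - (∑ i, normSq (g b (Sum.inr i))) * h2

include hα hαJ hb hσ in
theorem form_le_boundary {g : ℝ → Fin n ⊕ Fin n → ℂ} (hg : S.IsSolution w g)
    (hgb : boundaryMap n σ (g b) = 0) :
    σ * w.im * (S.form b g g).re ≤
      σ * (star (α *ᵥ g 0) ⬝ᵥ (α * Matrix.J (Fin n) ℂ) *ᵥ g 0).im := by
  rw [← S.form_add_boundary_eq hα hαJ hb hσ hg hgb]
  have : 0 ≤ ∑ i, normSq (g b (Sum.inr i)) := Finset.sum_nonneg fun i _ => normSq_nonneg _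
  linarith

/-- The values at `0` and at `b` that determine a solution on `[0, b]`. -/
noncomputable def boundaryValues (α : Matrix (Fin n) (Fin n ⊕ Fin n) ℂ) (σ : ℝ) (w : ℂ) (b : ℝ) :
    (Fin n ⊕ Fin n → ℂ) →ₗ[ℂ] (Fin n → ℂ) × (Fin n → ℂ) :=
  α.mulVecLin.prod (boundaryMap n σ ∘ₗ (S.fundamental w b).mulVecLin)

include hα hαJ hb hσ hw in
-- With zero data, two nonnegative terms in the energy identity add up to zero. The endpoint term
-- alone forces y(b) = 0, so definiteness on [0, b] is not needed.
theorem boundaryValues_injective : Function.Injective (S.boundaryValues α σ w b) := by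
  refine (injective_iff_map_eq_zero _).2 fun c hc => ?_
  obtain ⟨h1, h2⟩ := Prod.ext_iff.1 hc
  replace h1 : α *ᵥ c = 0 := h1
  replace h2 : boundaryMap n σ (S.solutionMap w c b) = 0 := h2
  have h := S.form_add_boundary_eq hα hαJ hb hσ (S.isSolution_solutionMap w c) h2
  rw [solutionMap_zero_right, h1, star_zero, zero_dotProduct, zero_im, mul_zero] at h
  have hp := mul_nonneg hw.le (S.form_self_re_nonneg hb (S.continuousOn_solutionMap w c))
  have hs : 0 ≤ ∑ i, normSq (S.solutionMap w c b (Sum.inr i)) :=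
    Finset.sum_nonneg fun i _ => normSq_nonneg _
  have hs0 : ∑ i, normSq (S.solutionMap w c b (Sum.inr i)) = 0 := by linarith
  have h3 : ∀ i, S.solutionMap w c b (Sum.inr i) = 0 := fun i => normSq_eq_zero.1
    ((Finset.sum_eq_zero_iff_of_nonneg fun i _ => normSq_nonneg _).1 hs0 i (Finset.mem_univ i))
  have h4 : S.fundamental w b *ᵥ c = 0 := by
    ext i
    rcases i with i | i
    · exact (eq_of_boundaryMap_eq_zero h2 i).trans (by rw [h3]; simp)
    · exact h3 i
  exact Matrix.mulVec_injective_of_isUnit (S.isUnit_fundamental w hb)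
    (h4.trans (Matrix.mulVec_zero _).symm)

include hα hαJ hb hσ hw in
/-- The boundary value problem on `[0, b]` is uniquely solvable, with linear dependence. -/
theorem exists_boundaryValues_inverse :
    ∃ R : (Fin n → ℂ) × (Fin n → ℂ) →ₗ[ℂ] (Fin n ⊕ Fin n → ℂ), ∀ p : (Fin n → ℂ) × (Fin n → ℂ),
      α *ᵥ R p = p.1 ∧ boundaryMap n σ (S.solutionMap w (R p) b) = p.2 := by
  let e := LinearEquiv.ofInjectiveOfFinrankEq (S.boundaryValues α σ w b)
    (S.boundaryValues_injective hα hαJ hb hσ hw) (by simp)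
  exact ⟨e.symm, fun p => Prod.ext_iff.1 (e.apply_symm_apply p)⟩

include hα hαJ hb hσ hw in
/-- Comparison of solutions at two spectral parameters with matching boundary values. -/
theorem form_sub_le {z : ℂ} {f g : ℝ → Fin n ⊕ Fin n → ℂ} (hf : S.IsSolution z f)
    (hg : S.IsSolution w g) (h0 : α *ᵥ g 0 = α *ᵥ f 0)
    (hfg : boundaryMap n σ (g b) = boundaryMap n σ (f b)) :
    w.im ^ 2 * (S.form b (f - g) (f - g)).re ≤ normSq (z - w) * (S.form b f f).re := by
  have hD : ∀ x : ℝ, star ((f - g) x) ⬝ᵥ Matrix.J (Fin n) ℂ *ᵥ (f - g) x =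
      star (f x) ⬝ᵥ Matrix.J (Fin n) ℂ *ᵥ f x - star (f x) ⬝ᵥ Matrix.J (Fin n) ℂ *ᵥ g x -
      star (g x) ⬝ᵥ Matrix.J (Fin n) ℂ *ᵥ f x + star (g x) ⬝ᵥ Matrix.J (Fin n) ℂ *ᵥ g x := by
    intro x
    simp only [Pi.sub_apply, star_sub, Matrix.mulVec_sub, sub_dotProduct, dotProduct_sub]
    ring
  have hend : 0 ≤ σ * (star ((f - g) b) ⬝ᵥ Matrix.J (Fin n) ℂ *ᵥ (f - g) b).im := by
    rw [star_dotProduct_J_im_of_boundaryMap (σ := σ) (by rw [Pi.sub_apply, map_sub, hfg, sub_self])]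
    have : 0 ≤ ∑ i, normSq ((f - g) b (Sum.inr i)) := Finset.sum_nonneg fun i _ => normSq_nonneg _
    have h2 : σ * σ = 1 := by rcases hσ with rfl | rfl <;> norm_num
    linear_combination 2 * this - 2 * (∑ i, normSq ((f - g) b (Sum.inr i))) * h2
  have hbeg : (star ((f - g) 0) ⬝ᵥ Matrix.J (Fin n) ℂ *ᵥ (f - g) 0).im = 0 := by
    rw [star_dotProduct_J_self_im hα hαJ, Pi.sub_apply, Matrix.mulVec_sub, h0, sub_self]
    simp
  rw [hD] at hend hbeg
  have hm := mul_nonneg hw.le hend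
  have e1 := congrArg im (S.green hf hf hb)
  have e2 := congrArg im (S.green hf hg hb)
  have e3 := congrArg im (S.green hg hf hb)
  have e4 := congrArg im (S.green hg hg hb)
  rw [← S.form_conj hb f g] at e3
  -- Cauchy–Schwarz as a completed square: with h = f - g the function is σ Im(w) h - iσ(z - w) f,
  -- and its nonnegative energy absorbs the cross term from Green's identity.
  have P := S.form_self_re_nonneg hb
    (((hf.continuousOn.const_smul ((σ * w.im : ℝ) - I * σ * (z - w))).add
      (hg.continuousOn.const_smul (-(σ * w.im : ℝ) : ℂ))))
  have P' := S.form_combination_re hb hf.continuousOn hg.continuousOn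
    ((σ * w.im : ℝ) - I * σ * (z - w)) (-(σ * w.im : ℝ) : ℂ)
  have Q := S.form_combination_re hb hf.continuousOn hg.continuousOn 1 (-1)
  rw [one_smul, neg_one_smul, ← sub_eq_add_neg] at Q
  change 0 ≤ (S.form b (((σ * w.im : ℝ) - I * σ * (z - w) : ℂ) • f + (-(σ * w.im : ℝ) : ℂ) • g)
    (((σ * w.im : ℝ) - I * σ * (z - w) : ℂ) • f + (-(σ * w.im : ℝ) : ℂ) • g)).re at P
  rw [P'] at P
  rw [Q]
  simp only [add_im, sub_im, sub_re, mul_im, mul_re, conj_re, conj_im, S.form_self_im hb, normSq_apply,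
    ofReal_re, ofReal_im, neg_re, neg_im, I_re, I_im, one_re, one_im] at *
  rcases hσ with rfl | rfl
  · linear_combination P + hm + w.im * (e1 - e2 - e3 + e4) + w.im * hbeg
  · linear_combination P + hm + w.im * (e1 - e2 - e3 + e4) + w.im * hbeg

end HalfLineCanonicalSystem

/-! ### The limit b → ∞. -/

/-- A bounded sequence converges along every ultrafilter finer than `atTop`. -/
theorem exists_tendsto_hyperfilter {V : Type*} [NormedAddCommGroup V] [ProperSpace V] {c : ℕ → V}
    {R : ℝ} (hc : ∀ᶠ k in Filter.atTop, ‖c k‖ ≤ R) :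
    ∃ l, Filter.Tendsto c (Filter.hyperfilter ℕ) (nhds l) := by
  obtain ⟨l, -, hl⟩ := (isCompact_closedBall (0 : V) R).ultrafilter_le_nhds'
    ((Filter.hyperfilter ℕ).map c) (by
      have h := hc.filter_mono Nat.hyperfilter_le_atTop
      exact h.mono fun k hk => by simpa using hk)
  exact ⟨l, hl⟩

namespace HalfLineCanonicalSystem

variable {n : ℕ} (S : HalfLineCanonicalSystem n)

/-- The initial values of the square integrable solutions at `z`. -/
noncomputable def initialValues (z : ℂ) : Submodule ℂ (Fin n ⊕ Fin n → ℂ) :=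
  S.preL2.comap (S.solutionMap z)

/-- The parallelogram law for f and f - g, with the energy of 2f - g discarded. -/
theorem form_sub_re_le {b : ℝ} (hb : 0 ≤ b) {f g : ℝ → Fin n ⊕ Fin n → ℂ}
    (hf : ContinuousOn f (Ici 0)) (hg : ContinuousOn g (Ici 0)) :
    (S.form b g g).re ≤ 2 * (S.form b f f).re + 2 * (S.form b (f - g) (f - g)).re := by
  have h1 := S.form_combination_re hb hf hg 1 (-1)
  have h2 := S.form_combination_re hb hf hg 2 (-1)
  have h3 := S.form_self_re_nonneg hb ((hf.const_smul (2 : ℂ)).add (hg.const_smul (-1 : ℂ)))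
  rw [one_smul, neg_one_smul, ← sub_eq_add_neg] at h1
  change 0 ≤ (S.form b ((2 : ℂ) • f + (-1 : ℂ) • g) ((2 : ℂ) • f + (-1 : ℂ) • g)).re at h3
  rw [h2] at h3
  rw [h1]
  simp [normSq_apply] at h3 ⊢
  linarith

section Limits

variable {S} (hdef : S.IsDefinite) {α : Matrix (Fin n) (Fin n ⊕ Fin n) ℂ} (hα : α * αᴴ = 1)
  (hαJ : α * Matrix.J (Fin n) ℂ * αᴴ = 0)

theorem sign_im_eq {w : ℂ} (hw : w.im ≠ 0) : Real.sign w.im = 1 ∨ Real.sign w.im = -1 :=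
  (Real.sign_apply_eq_of_ne_zero _ hw).symm

include hdef hα hαJ in
/-- Every square integrable solution at `z` is approximated by one at a nearby `w`, linearly. -/
theorem exists_comparison_map (z : ℂ) {w : ℂ} (hw : w.im ≠ 0) :
    ∃ G : S.initialValues z →ₗ[ℂ] (Fin n ⊕ Fin n → ℂ), ∀ (c : S.initialValues z) (B : ℕ),
      w.im ^ 2 * (S.form B (S.solutionMap z c - S.solutionMap w (G c))
        (S.solutionMap z c - S.solutionMap w (G c))).re ≤
      normSq (z - w) * (S.energy (S.solutionMap z c)).toReal := by
  have hσ := sign_im_eq hw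
  have hpos := Real.sign_mul_pos_of_ne_zero _ hw
  choose R hR using fun k : ℕ =>
    S.exists_boundaryValues_inverse hα hαJ (Nat.cast_nonneg k) hσ hpos
  -- The initial value of the solution at w that shares its boundary data at 0 and k with the given
  -- solution at z.
  let r : ℕ → S.initialValues z →ₗ[ℂ] (Fin n ⊕ Fin n → ℂ) := fun k =>
    R k ∘ₗ S.boundaryValues α (Real.sign w.im) z k ∘ₗ (S.initialValues z).subtype
  have hw2 : 0 < w.im ^ 2 := by positivity
  have key : ∀ (c : S.initialValues z) (B k : ℕ), B ≤ k →
      w.im ^ 2 * (S.form B (S.solutionMap z c - S.solutionMap w (r k c))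
        (S.solutionMap z c - S.solutionMap w (r k c))).re ≤
      normSq (z - w) * (S.energy (S.solutionMap z c)).toReal := by
    intro c B k hBk
    have hcz := S.isSolution_solutionMap z c
    have hcw := S.isSolution_solutionMap w (r k c)
    have hRk := hR k (S.boundaryValues α (Real.sign w.im) z k c)
    refine (mul_le_mul_of_nonneg_left (S.form_self_re_mono B.cast_nonneg
      (hcz.continuousOn.sub hcw.continuousOn) (Nat.cast_le.2 hBk)) hw2.le).trans ?_
    refine (S.form_sub_le hα hαJ k.cast_nonneg hσ hpos hcz hcw ?_ hRk.2).trans ?_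
    · rw [solutionMap_zero_right, solutionMap_zero_right]
      exact hRk.1
    · exact mul_le_mul_of_nonneg_left (S.form_le_energy k.cast_nonneg hcz.continuousOn c.2)
        (normSq_nonneg _)
  obtain ⟨N, δ, hδ, hN⟩ := hdef.exists_lower_bound w
  have hlim : ∀ c : S.initialValues z,
      ∃ l, Filter.Tendsto (fun k => r k c) (Filter.hyperfilter ℕ) (nhds l) := by
    intro c
    set e := (S.energy (S.solutionMap z c)).toReal with he
    refine exists_tendsto_hyperfilter
      (R := Real.sqrt ((2 * e + 2 * (normSq (z - w) * e / w.im ^ 2)) / δ)) ?_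
    filter_upwards [Filter.eventually_ge_atTop N] with k hk
    refine Real.le_sqrt_of_sq_le ?_
    rw [le_div_iff₀ hδ, mul_comm]
    refine (hN N le_rfl (r k c)).trans ?_
    refine (S.form_sub_re_le N.cast_nonneg (S.continuousOn_solutionMap z c)
      (S.continuousOn_solutionMap w (r k c))).trans ?_
    have h1 := S.form_le_energy (b := N) N.cast_nonneg (S.continuousOn_solutionMap z c) c.2
    have h2 := key c N k hk
    rw [mul_comm, ← le_div_iff₀ hw2] at h2
    linarith
  -- One fixed ultrafilter serves every c, so linearity passes to the limit without choosing
  -- subsequences.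
  choose l hl using hlim
  refine ⟨{ toFun := l, map_add' := fun c d => ?_, map_smul' := fun t c => ?_ }, fun c B => ?_⟩
  · refine tendsto_nhds_unique (hl (c + d)) ?_
    simpa only [map_add] using (hl c).add (hl d)
  · refine tendsto_nhds_unique (hl (t • c)) ?_
    simpa only [map_smul, RingHom.id_apply] using (hl c).const_smul t
  · have hcont := ((S.continuous_form_sub_solutionMap B.cast_nonneg
      (S.continuousOn_solutionMap z c) w).tendsto (l c)).comp (hl c)
    refine le_of_tendsto (hcont.const_mul (w.im ^ 2)) ?_
    have h := (Filter.eventually_ge_atTop B).filter_mono Nat.hyperfilter_le_atTop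
    filter_upwards [h] with k hk
    exact key c B k hk

include hdef hα hαJ in
-- The comparison map is injective: if it kills c, the energy E < ∞ of the solution satisfies E ≤ qE
-- with q = |z - w|²/(Im w)² < 1.
theorem finrank_initialValues_le {z w : ℂ} (hzw : ‖z - w‖ < |w.im|) :
    Module.finrank ℂ (S.initialValues z) ≤ Module.finrank ℂ (S.initialValues w) := by
  have hw : w.im ≠ 0 := abs_pos.1 ((norm_nonneg _).trans_lt hzw)
  have hw2 : 0 < w.im ^ 2 := by positivity
  have hq : normSq (z - w) < w.im ^ 2 := by
    rw [normSq_eq_norm_sq, ← sq_abs w.im]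
    exact pow_lt_pow_left₀ hzw (norm_nonneg _) two_ne_zero
  obtain ⟨G, hG⟩ := exists_comparison_map hdef hα hαJ z hw
  have hmem : ∀ c, G c ∈ S.initialValues w := by
    intro c
    refine S.mem_preL2_of_forall_form_le (S.continuousOn_solutionMap w (G c))
      (C := 2 * (S.energy (S.solutionMap z c)).toReal +
        2 * (normSq (z - w) * (S.energy (S.solutionMap z c)).toReal / w.im ^ 2)) fun k => ?_
    refine (S.form_sub_re_le k.cast_nonneg (S.continuousOn_solutionMap z c)
      (S.continuousOn_solutionMap w (G c))).trans ?_
    have h1 := S.form_le_energy (b := k) k.cast_nonneg (S.continuousOn_solutionMap z c) c.2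
    have h2 := hG c k
    rw [mul_comm, ← le_div_iff₀ hw2] at h2
    linarith
  refine LinearMap.finrank_le_finrank_of_injective (f := G.codRestrict _ hmem) ?_
  refine (injective_iff_map_eq_zero _).2 fun c hc => ?_
  have hc0 : G c = 0 := congrArg Subtype.val hc
  have hE : (S.energy (S.solutionMap z c)).toReal = 0 := by
    by_contra hne
    have hpos : 0 < (S.energy (S.solutionMap z c)).toReal :=
      lt_of_le_of_ne ENNReal.toReal_nonneg (Ne.symm hne)
    have hle : S.energy (S.solutionMap z c) ≤
        ENNReal.ofReal (normSq (z - w) * (S.energy (S.solutionMap z c)).toReal / w.im ^ 2) := by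
      conv_lhs => rw [S.energy_eq_iSup (S.continuousOn_solutionMap z c)]
      refine iSup_le fun k => ENNReal.ofReal_le_ofReal ?_
      have h := hG c k
      rw [hc0, map_zero, sub_zero] at h
      rwa [le_div_iff₀ hw2, mul_comm]
    have h1 := ENNReal.toReal_le_of_le_ofReal (by have := normSq_nonneg (z - w); positivity) hle
    rw [le_div_iff₀ hw2] at h1
    nlinarith
  refine Subtype.ext (hdef.eq_zero_of_energy (w := z) ?_)
  exact ((ENNReal.toReal_eq_zero_iff _).1 hE).resolve_right c.2.2.ne

include hdef hα hαJ in
/-- Square integrable solutions with prescribed boundary value at `0`, obtained as limits of the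
solutions of regular boundary value problems. -/
theorem exists_weyl_solutions :
    ∃ χ : ℂ → (Fin n → ℂ) → (Fin n ⊕ Fin n → ℂ),
      (∀ w : ℂ, w.im ≠ 0 → ∀ a, χ w a ∈ S.initialValues w ∧ α *ᵥ χ w a = a ∧
        ∀ B : ℕ, Real.sign w.im * w.im *
            (S.form B (S.solutionMap w (χ w a)) (S.solutionMap w (χ w a))).re ≤
          Real.sign w.im * (star a ⬝ᵥ (α * Matrix.J (Fin n) ℂ) *ᵥ χ w a).im) ∧
      ∀ w : ℂ, w.im ≠ 0 → ∀ a a',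
        star (χ (conj w) a') ⬝ᵥ Matrix.J (Fin n) ℂ *ᵥ χ w a = 0 := by
  have hR : ∀ (w : ℂ) (a : Fin n → ℂ) (k : ℕ), ∃ c : Fin n ⊕ Fin n → ℂ, w.im ≠ 0 →
      α *ᵥ c = a ∧ boundaryMap n (Real.sign w.im) (S.solutionMap w c k) = 0 := by
    intro w a k
    by_cases hw : w.im = 0
    · exact ⟨0, fun h => absurd hw h⟩
    · obtain ⟨R, hR⟩ := S.exists_boundaryValues_inverse hα hαJ (Nat.cast_nonneg k)
        (sign_im_eq hw) (Real.sign_mul_pos_of_ne_zero _ hw)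
      exact ⟨R (a, 0), fun _ => hR (a, 0)⟩
  choose r hr using hR
  have key : ∀ w : ℂ, w.im ≠ 0 → ∀ (a : Fin n → ℂ) (B k : ℕ), B ≤ k →
      Real.sign w.im * w.im *
        (S.form B (S.solutionMap w (r w a k)) (S.solutionMap w (r w a k))).re ≤
      Real.sign w.im * (star a ⬝ᵥ (α * Matrix.J (Fin n) ℂ) *ᵥ r w a k).im := by
    intro w hw a B k hBk
    have hsol := S.isSolution_solutionMap w (r w a k)
    have hb := hr w a k hw
    refine (mul_le_mul_of_nonneg_left (S.form_self_re_mono B.cast_nonneg hsol.continuousOn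
      (Nat.cast_le.2 hBk)) (Real.sign_mul_pos_of_ne_zero _ hw).le).trans ?_
    have h := S.form_le_boundary hα hαJ (Nat.cast_nonneg k) (sign_im_eq hw) hsol hb.2
    rwa [solutionMap_zero_right, hb.1] at h
  have cont : ∀ a : Fin n → ℂ, Continuous fun c : Fin n ⊕ Fin n → ℂ =>
      star a ⬝ᵥ (α * Matrix.J (Fin n) ℂ) *ᵥ c := fun a => by fun_prop
  have hlim : ∀ (w : ℂ) (a : Fin n → ℂ), ∃ l, w.im ≠ 0 →
      Filter.Tendsto (r w a) (Filter.hyperfilter ℕ) (nhds l) := by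
    intro w a
    by_cases hw : w.im = 0
    · exact ⟨0, fun h => absurd hw h⟩
    obtain ⟨N, δ, hδ, hN⟩ := hdef.exists_lower_bound w
    have hy := Real.sign_mul_pos_of_ne_zero _ hw
    let l : (Fin n ⊕ Fin n → ℂ) →ₗ[ℂ] ℂ :=
      { toFun := fun c => star a ⬝ᵥ (α * Matrix.J (Fin n) ℂ) *ᵥ c
        map_add' := fun c d => by rw [Matrix.mulVec_add, dotProduct_add]
        map_smul' := fun t c => by rw [Matrix.mulVec_smul, dotProduct_smul]; rfl }
    let L := l.toContinuousLinearMap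
    -- The energy dominates δ‖c‖² while the boundary term is at most ‖L‖‖c‖; dividing by ‖c‖ gives
    -- this radius.
    obtain ⟨m, hm⟩ := exists_tendsto_hyperfilter (c := r w a)
      (R := ‖L‖ / (Real.sign w.im * w.im * δ)) (by
        filter_upwards [Filter.eventually_ge_atTop N] with k hk
        have h1 := hN N le_rfl (r w a k)
        have h2 := key w hw a N k hk
        have h3 : Real.sign w.im * (star a ⬝ᵥ (α * Matrix.J (Fin n) ℂ) *ᵥ r w a k).im ≤
            ‖L‖ * ‖r w a k‖ := by
          refine le_trans ?_ (L.le_opNorm _)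
          refine le_trans ?_ (Complex.abs_im_le_norm _)
          change _ ≤ |(star a ⬝ᵥ (α * Matrix.J (Fin n) ℂ) *ᵥ r w a k).im|
          rcases sign_im_eq hw with h | h <;> rw [h]
          · rw [one_mul]; exact le_abs_self _
          · rw [neg_one_mul]; exact neg_le_abs _
        have h4 := (mul_le_mul_of_nonneg_left h1 hy.le).trans (h2.trans h3)
        rw [le_div_iff₀ (mul_pos hy hδ)]
        rcases (norm_nonneg (r w a k)).eq_or_lt with h0 | h0
        · rw [← h0, zero_mul]; exact norm_nonneg _
        · refine le_of_mul_le_mul_right ?_ h0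
          linarith)
    exact ⟨m, fun _ => hm⟩
  choose χ hχ using hlim
  have hbound : ∀ w : ℂ, w.im ≠ 0 → ∀ a, ∀ B : ℕ, Real.sign w.im * w.im *
      (S.form B (S.solutionMap w (χ w a)) (S.solutionMap w (χ w a))).re ≤
      Real.sign w.im * (star a ⬝ᵥ (α * Matrix.J (Fin n) ℂ) *ᵥ χ w a).im := by
    intro w hw a B
    have t1 := ((continuous_re.comp
      (S.continuous_form_solutionMap_self B.cast_nonneg w)).tendsto (χ w a)).comp (hχ w a hw)
    have t2 := ((continuous_im.comp (cont a)).tendsto (χ w a)).comp (hχ w a hw)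
    refine le_of_tendsto_of_tendsto (t1.const_mul _) (t2.const_mul _) ?_
    filter_upwards [(Filter.eventually_ge_atTop B).filter_mono Nat.hyperfilter_le_atTop] with k hk
    exact key w hw a B k hk
  refine ⟨χ, fun w hw a => ⟨?_, ?_, hbound w hw a⟩, fun w hw a a' => ?_⟩
  · refine S.mem_preL2_of_forall_form_le (S.continuousOn_solutionMap w (χ w a))
      (C := Real.sign w.im * (star a ⬝ᵥ (α * Matrix.J (Fin n) ℂ) *ᵥ χ w a).im /
        (Real.sign w.im * w.im)) fun k => ?_
    have h := hbound w hw a k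
    rw [mul_comm, ← le_div_iff₀ (Real.sign_mul_pos_of_ne_zero _ hw)] at h
    exact h
  · have hc : Continuous fun c : Fin n ⊕ Fin n → ℂ => α *ᵥ c := by fun_prop
    have t := (hc.tendsto (χ w a)).comp (hχ w a hw)
    refine tendsto_nhds_unique t ?_
    exact tendsto_const_nhds.congr fun k => ((hr w a k hw).1).symm
  · have hw' : (conj w).im ≠ 0 := by simpa using hw
    have hc : Continuous fun p : (Fin n ⊕ Fin n → ℂ) × (Fin n ⊕ Fin n → ℂ) =>
        star p.1 ⬝ᵥ Matrix.J (Fin n) ℂ *ᵥ p.2 := by fun_prop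
    have t := (hc.tendsto (χ (conj w) a', χ w a)).comp
      ((hχ (conj w) a' hw').prodMk_nhds (hχ w a hw))
    refine tendsto_nhds_unique t (tendsto_const_nhds.congr fun k => ?_)
    -- The conditions at k for w and conj w carry opposite signs, so the endpoint values are
    -- J-orthogonal; constancy of the J-form brings this back to 0.
    have h1 := (hr w a k hw).2
    have h2 := (hr (conj w) a' k hw').2
    rw [conj_im, Real.sign_neg] at h2
    have h3 := star_dotProduct_J_eq_zero_of_boundaryMap h1 h2
    rw [S.star_dotProduct_J_solutionMap w (S.isSolution_solutionMap w _) _ k.cast_nonneg,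
      solutionMap_zero_right] at h3
    exact h3.symm

end Limits

end HalfLineCanonicalSystem

/-! ### The dimension bound at nonreal points. -/

namespace HalfLineCanonicalSystem

variable {n : ℕ} {S : HalfLineCanonicalSystem n}

/-- Square integrable solutions at `z` span a subspace of the defect space at `z`. -/
theorem IsDefinite.rank_initialValues_le (hdef : S.IsDefinite) (z : ℂ) :
    Module.rank ℂ (S.initialValues z) ≤ S.defect z := by
  let ι : S.initialValues z →ₗ[ℂ] S.preL2 :=
    ((S.solutionMap z).domRestrict (S.initialValues z)).codRestrict S.preL2 fun c => c.2
  have hmem : ∀ c, (S.nullSpace.mkQ ∘ₗ ι) c ∈ S.defectSpace z := by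
    intro c
    have hsol := S.isSolution_solutionMap z c
    refine ⟨ι c, z • ι c, rfl, by simp, fun a b ha hb => ?_, ?_⟩
    · refine (hsol.1 (max a b) (lt_max_of_lt_left ha)).mono ?_
      rw [uIcc_of_le (ha.le.trans (le_max_left a b))]
      exact uIcc_subset_Icc ⟨ha.le, le_max_left a b⟩ ⟨hb.le, le_max_right a b⟩
    · filter_upwards [hsol.2] with x ⟨d, hd, e⟩
      refine ⟨d, hd, ?_⟩
      rw [e]
      change _ = -(S.H x *ᵥ (z • S.solutionMap z c x))
      rw [Matrix.mulVec_smul]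
  refine LinearMap.rank_le_of_injective ((S.nullSpace.mkQ ∘ₗ ι).codRestrict _ hmem) ?_
  refine (injective_iff_map_eq_zero _).2 fun c hc => ?_
  have h : S.nullSpace.mkQ (ι c) = 0 := congrArg Subtype.val hc
  rw [Submodule.mkQ_apply, Submodule.Quotient.mk_eq_zero] at h
  exact Subtype.ext (hdef.eq_zero_of_energy (w := z) h)

/-- Since s² = 1, |z - ist|² = |z|² - 2st Im z + t². -/
theorem norm_sub_mul_I_lt {z : ℂ} {s t : ℝ} (hs : s = 1 ∨ s = -1)
    (h : normSq z < 2 * t * (s * z.im)) : ‖z - (s * t : ℝ) * I‖ < |((s * t : ℝ) * I : ℂ).im| := by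
  rw [← sq_lt_sq₀ (norm_nonneg _) (abs_nonneg _), ← normSq_eq_norm_sq, sq_abs]
  simp only [normSq_apply, sub_re, sub_im, mul_re, mul_im, ofReal_re, ofReal_im, I_re, I_im] at h ⊢
  rcases hs with rfl | rfl <;> nlinarith

/-- If the deficiency indices are at most `n`, then so are the dimensions of the spaces of square
integrable solutions at all nonreal points. -/
theorem IsDefinite.finrank_initialValues_le (hdef : S.IsDefinite)
    (hpos : S.defect I = (n : Cardinal)) (hneg : S.defect (-I) = (n : Cardinal))
    {α : Matrix (Fin n) (Fin n ⊕ Fin n) ℂ} (hα : α * αᴴ = 1)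
    (hαJ : α * Matrix.J (Fin n) ℂ * αᴴ = 0) {z : ℂ} (hz : z.im ≠ 0) :
    Module.finrank ℂ (S.initialValues z) ≤ n := by
  have hs := sign_im_eq hz
  have hsz := Real.sign_mul_pos_of_ne_zero _ hz
  generalize Real.sign z.im = s at hs hsz
  have hsI : Module.finrank ℂ (S.initialValues (s * I)) ≤ n := by
    refine Module.finrank_le_of_rank_le ((hdef.rank_initialValues_le _).trans ?_)
    rcases hs with rfl | rfl
    · simpa using hpos.le
    · simpa using hneg.le
  -- Any ratio strictly between 1 and 2 would do: each point must lie in the disc about the previous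
  -- one that touches the real axis.
  have hpow : ∀ k : ℕ, Module.finrank ℂ (S.initialValues ((s * (3 / 2) ^ k : ℝ) * I)) ≤ n := by
    intro k
    induction k with
    | zero => rwa [pow_zero, mul_one]
    | succ k ih =>
      have hk : (0 : ℝ) < (3 / 2) ^ k := by positivity
      refine (HalfLineCanonicalSystem.finrank_initialValues_le hdef hα hαJ
        (norm_sub_mul_I_lt hs ?_)).trans ih
      simp only [normSq_apply, mul_re, mul_im, ofReal_re, ofReal_im, I_re, I_im, pow_succ]
      rcases hs with rfl | rfl <;> nlinarith
  -- The discs about ist of radius t exhaust the half plane of z as t grows.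
  obtain ⟨k, hk⟩ := pow_unbounded_of_one_lt (normSq z / (s * z.im)) (by norm_num : (1 : ℝ) < 3 / 2)
  rw [div_lt_iff₀ hsz] at hk
  have hk0 : (0 : ℝ) < (3 / 2) ^ k := by positivity
  have := mul_pos hk0 hsz
  exact (HalfLineCanonicalSystem.finrank_initialValues_le hdef hα hαJ
    (norm_sub_mul_I_lt hs (by linarith))).trans (hpow k)

/-! ### The Weyl matrix in terms of initial values. -/

/-- The initial value of the column combination `(v + u M) a`. -/
noncomputable def weylInitial (α : Matrix (Fin n) (Fin n ⊕ Fin n) ℂ) (M : Matrix (Fin n) (Fin n) ℂ)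
    (a : Fin n → ℂ) : Fin n ⊕ Fin n → ℂ :=
  (αᴴ - Matrix.J (Fin n) ℂ * αᴴ * M) *ᵥ a

section Weyl

variable {α : Matrix (Fin n) (Fin n ⊕ Fin n) ℂ} (hα : α * αᴴ = 1)
  (hαJ : α * Matrix.J (Fin n) ℂ * αᴴ = 0)

include hα hαJ in
theorem mulVec_weylInitial (M : Matrix (Fin n) (Fin n) ℂ) (a : Fin n → ℂ) :
    α *ᵥ weylInitial α M a = a := by
  rw [weylInitial, Matrix.mulVec_mulVec, Matrix.mul_sub, ← Matrix.mul_assoc, ← Matrix.mul_assoc,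
    hα, hαJ, Matrix.zero_mul, sub_zero, Matrix.one_mulVec]

include hα hαJ in
theorem mul_J_mulVec_weylInitial (M : Matrix (Fin n) (Fin n) ℂ) (a : Fin n → ℂ) :
    (α * Matrix.J (Fin n) ℂ) *ᵥ weylInitial α M a = M *ᵥ a := by
  have h : α * Matrix.J (Fin n) ℂ * (Matrix.J (Fin n) ℂ * αᴴ * M) = -M := by
    rw [Matrix.mul_assoc α, Matrix.mul_assoc (Matrix.J (Fin n) ℂ) αᴴ, ← Matrix.mul_assoc _ _ (αᴴ * M),
      Matrix.J_squared, Matrix.neg_mul, Matrix.one_mul, Matrix.mul_neg, ← Matrix.mul_assoc, hα,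
      Matrix.one_mul]
  rw [weylInitial, Matrix.mulVec_mulVec, Matrix.mul_sub, hαJ, h, zero_sub, neg_neg]

theorem matrixSolution_eq (C : Matrix (Fin n ⊕ Fin n) (Fin n) ℂ) (z : ℂ) {x : ℝ} (hx : 0 ≤ x) :
    S.matrixSolution C z x = S.fundamental z x * C := by
  ext i j
  have h := S.eq_solutionMap (S.solution_spec z fun k => C k j).1 hx
  rw [(S.solution_spec z fun k => C k j).2] at h
  exact congrFun h i

theorem mem_preL2_congr {f g : ℝ → Fin n ⊕ Fin n → ℂ} (h : ∀ x, 0 ≤ x → f x = g x)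
    (hf : f ∈ S.preL2) : g ∈ S.preL2 := by
  have hae : f =ᵐ[volume.restrict (Ioi (0 : ℝ))] g := by
    filter_upwards [ae_restrict_mem measurableSet_Ioi] with x hx
    exact h x (le_of_lt hx)
  refine ⟨hf.1.congr hae, lt_of_eq_of_lt (lintegral_congr_ae ?_) hf.2⟩
  filter_upwards [hae] with x hx
  simp only [energyDensity, hx]

/-- `u` and `v` are chosen solutions, determined only on [0, ∞), but membership in `preL2` sees only
(0, ∞). Linearity passes from the columns to all a. -/
theorem columnsInL2H_iff (z : ℂ) (M : Matrix (Fin n) (Fin n) ℂ) :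
    S.ColumnsInL2H (fun x => S.v α z x + S.u α z x * M) ↔
      ∀ a, weylInitial α M a ∈ S.initialValues z := by
  have key : ∀ x, 0 ≤ x → S.v α z x + S.u α z x * M =
      S.fundamental z x * (αᴴ - Matrix.J (Fin n) ℂ * αᴴ * M) := by
    intro x hx
    rw [v, u, matrixSolution_eq _ _ hx, matrixSolution_eq _ _ hx, Matrix.mul_sub, Matrix.mul_neg,
      Matrix.neg_mul, Matrix.mul_assoc (S.fundamental z x), sub_eq_add_neg]
  have hcol : ∀ j x, 0 ≤ x → (fun i => (S.v α z x + S.u α z x * M) i j) =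
      S.solutionMap z (weylInitial α M (Pi.single j 1)) x := by
    intro j x hx
    rw [key x hx]
    change _ = S.fundamental z x *ᵥ ((αᴴ - Matrix.J (Fin n) ℂ * αᴴ * M) *ᵥ Pi.single j 1)
    rw [Matrix.mulVec_mulVec, Matrix.mulVec_single_one]
    rfl
  constructor
  · intro h a
    have ha : weylInitial α M a = ∑ j, a j • weylInitial α M (Pi.single j 1) := by
      simp only [weylInitial, ← Matrix.mulVec_smul, ← Matrix.mulVec_sum]
      congr 1
      ext i
      simp [Pi.single_apply]
    rw [ha]
    exact Submodule.sum_mem _ fun j _ => Submodule.smul_mem _ _ (mem_preL2_congr (hcol j) (h j))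
  · intro h j
    exact mem_preL2_congr (fun x hx => (hcol j x hx).symm) (h (Pi.single j 1))

end Weyl

end HalfLineCanonicalSystem

/-! ### Imaginary parts and the main theorem. -/

theorem star_dotProduct_matrixIm {n : ℕ} (M : Matrix (Fin n) (Fin n) ℂ) (a : Fin n → ℂ) :
    star a ⬝ᵥ matrixIm M *ᵥ a = ((star a ⬝ᵥ M *ᵥ a).im : ℂ) := by
  have h : star a ⬝ᵥ Mᴴ *ᵥ a = conj (star a ⬝ᵥ M *ᵥ a) := by
    rw [starRingEnd_apply, Matrix.star_dotProduct, Matrix.star_mulVec,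
      Matrix.conjTranspose_conjTranspose, Matrix.dotProduct_mulVec]
  rw [matrixIm, Matrix.smul_mulVec, dotProduct_smul, Matrix.sub_mulVec, dotProduct_sub, h, sub_conj,
    smul_eq_mul]
  field_simp
  push_cast
  rfl

theorem isHermitian_matrixIm {n : ℕ} (M : Matrix (Fin n) (Fin n) ℂ) : (matrixIm M).IsHermitian := by
  rw [Matrix.IsHermitian, matrixIm, Matrix.conjTranspose_smul, Matrix.conjTranspose_sub,
    Matrix.conjTranspose_conjTranspose, ← neg_sub M, smul_neg, ← neg_smul]
  congr 1
  simp

theorem mainTheorem8 (n : ℕ) (S : HalfLineCanonicalSystem n) (hdef : S.IsDefinite)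
    (hpos : S.defect Complex.I = (n : Cardinal)) (hneg : S.defect (-Complex.I) = (n : Cardinal))
    (α : Matrix (Fin n) (Fin n ⊕ Fin n) ℂ)
    (hα : α * αᴴ = 1) (hαJ : α * Matrix.J (Fin n) ℂ * αᴴ = 0) :
    (∀ z : ℂ, z.im ≠ 0 →
      ∃! M : Matrix (Fin n) (Fin n) ℂ, S.ColumnsInL2H fun x => S.v α z x + S.u α z x * M) ∧
    ∀ m : ℂ → Matrix (Fin n) (Fin n) ℂ,
      (∀ z : ℂ, z.im ≠ 0 → S.ColumnsInL2H fun x => S.v α z x + S.u α z x * m z) →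
      (∀ z : ℂ, 0 < z.im → (matrixIm (m z)).PosDef) ∧
      (∀ z : ℂ, z.im ≠ 0 → m (conj z) = (m z)ᴴ) := by
  obtain ⟨χ, hχ, hχs⟩ := HalfLineCanonicalSystem.exists_weyl_solutions hdef hα hαJ
  -- α maps a space of dimension at most n onto ℂ^n, so its kernel there is trivial.
  have huniq : ∀ z : ℂ, z.im ≠ 0 → ∀ c ∈ S.initialValues z, ∀ d ∈ S.initialValues z,
      α *ᵥ c = α *ᵥ d → c = d := by
    intro z hz c hc d hd hcd
    let l : S.initialValues z →ₗ[ℂ] (Fin n → ℂ) := α.mulVecLin.domRestrict (S.initialValues z)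
    have hsurj : LinearMap.range l = ⊤ :=
      LinearMap.range_eq_top.2 fun a => ⟨⟨χ z a, (hχ z hz a).1⟩, (hχ z hz a).2.1⟩
    have hdim := l.finrank_range_add_finrank_ker
    rw [hsurj, finrank_top, Module.finrank_fin_fun] at hdim
    have hle := hdef.finrank_initialValues_le hpos hneg hα hαJ hz
    have hker : LinearMap.ker l = ⊥ := Submodule.finrank_eq_zero.1 (by omega)
    exact congrArg Subtype.val (LinearMap.ker_eq_bot.1 hker
      (a₁ := ⟨c, hc⟩) (a₂ := ⟨d, hd⟩) hcd)
  have hident : ∀ z : ℂ, z.im ≠ 0 → ∀ M : Matrix (Fin n) (Fin n) ℂ,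
      S.ColumnsInL2H (fun x => S.v α z x + S.u α z x * M) →
      ∀ a, χ z a = HalfLineCanonicalSystem.weylInitial α M a := by
    intro z hz M hM a
    refine huniq z hz _ (hχ z hz a).1 _ ((HalfLineCanonicalSystem.columnsInL2H_iff z M).1 hM a) ?_
    rw [(hχ z hz a).2.1, HalfLineCanonicalSystem.mulVec_weylInitial hα hαJ]
  have hM : ∀ z : ℂ, z.im ≠ 0 → ∀ M : Matrix (Fin n) (Fin n) ℂ,
      S.ColumnsInL2H (fun x => S.v α z x + S.u α z x * M) →
      ∀ a, M *ᵥ a = (α * Matrix.J (Fin n) ℂ) *ᵥ χ z a := by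
    intro z hz M hM a
    rw [hident z hz M hM a, HalfLineCanonicalSystem.mul_J_mulVec_weylInitial hα hαJ]
  refine ⟨fun z hz => ?_, fun m hm => ⟨fun z hz => ?_, fun z hz => ?_⟩⟩
  -- χ was chosen separately for each a and is not yet known to be linear, so M is built from basis
  -- vectors only.
  · let c : Fin n → Fin n ⊕ Fin n → ℂ := fun j => χ z (Pi.single j 1)
    let M : Matrix (Fin n) (Fin n) ℂ :=
      Matrix.of fun i j => ((α * Matrix.J (Fin n) ℂ) *ᵥ c j) i
    have hMc : ∀ j, M *ᵥ Pi.single j 1 = (α * Matrix.J (Fin n) ℂ) *ᵥ c j := fun j => by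
      rw [Matrix.mulVec_single_one]; rfl
    refine ⟨M, (HalfLineCanonicalSystem.columnsInL2H_iff z M).2 fun a => ?_, fun M' hM' => ?_⟩
    · have hsingle : ∀ j, HalfLineCanonicalSystem.weylInitial α M (Pi.single j 1) = c j := by
        intro j
        rw [HalfLineCanonicalSystem.weylInitial, Matrix.sub_mulVec, ← Matrix.mulVec_mulVec, hMc]
        conv_rhs => rw [eq_of_boundary_values hα hαJ (c j), (hχ z hz _).2.1]
      have ha : HalfLineCanonicalSystem.weylInitial α M a = ∑ j, a j • c j := by
        simp only [← hsingle]
        simp only [HalfLineCanonicalSystem.weylInitial, ← Matrix.mulVec_smul, ← Matrix.mulVec_sum]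
        congr 1
        ext i
        simp [Pi.single_apply]
      rw [ha]
      exact Submodule.sum_mem _ fun j _ => Submodule.smul_mem _ _ (hχ z hz _).1
    · exact Matrix.ext_of_mulVec_single fun j => (hM z hz M' hM' _).trans (hMc j).symm
  · refine Matrix.PosDef.of_dotProduct_mulVec_pos (isHermitian_matrixIm _) fun a ha => ?_
    rw [star_dotProduct_matrixIm, hM z hz.ne' _ (hm z hz.ne') a]
    obtain ⟨-, hαχ, hle⟩ := hχ z hz.ne' a
    obtain ⟨N, δ, hδ, hN⟩ := hdef.exists_lower_bound z
    -- Strict positivity: a nonzero initial value has positive energy on [0, N].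
    have hχ0 : χ z a ≠ 0 := fun h => ha (by rw [← hαχ, h, Matrix.mulVec_zero])
    have h1 := hN N le_rfl (χ z a)
    have h2 := hle N
    rw [Real.sign_of_pos hz, one_mul, one_mul] at h2
    have h3 : 0 < δ * ‖χ z a‖ ^ 2 := mul_pos hδ (pow_pos (norm_pos_iff.2 hχ0) 2)
    exact_mod_cast (mul_pos hz (h3.trans_le h1)).trans_le h2
  · have hz' : (conj z).im ≠ 0 := by simpa using hz
    -- The J-orthogonality of χ at conj z and z, written in the coordinates α and αJ.
    have key : ∀ a a', star a' ⬝ᵥ m z *ᵥ a = star (m (conj z) *ᵥ a') ⬝ᵥ a := by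
      intro a a'
      have h := hχs z hz a a'
      rw [star_dotProduct_J_boundary hα hαJ, (hχ z hz a).2.1, (hχ _ hz' a').2.1,
        ← hM z hz _ (hm z hz), ← hM _ hz' _ (hm _ hz')] at h
      exact sub_eq_zero.1 h
    ext i j
    have h := key (Pi.single i 1) (Pi.single j 1)
    have hs : star (Pi.single j 1 : Fin n → ℂ) = Pi.single j 1 := by
      rw [← Pi.single_star, star_one]
    rw [hs, single_one_dotProduct, dotProduct_single_one, Matrix.mulVec_single_one,
      Matrix.mulVec_single_one] at h
    rw [Matrix.conjTranspose_apply]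
    exact (star_eq_iff_star_eq.1 h.symm).symm
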